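/- For a finite simple graph $H$ with Laplacian matrix $L_H=D_H-A_H$, put $U_{L_H}(\tau)=\exp(-\mathrm{i}\tau L_H)$, $\tau\in\mathbb{R}$, and let $\mathbf e_v$ denote the characteristic vector of a vertex $v$. The pair state of a pair $\{a,b\}$ of distinct vertices is $\mathbf e_a-\mathbf e_b$ (determined up to sign); the pair states of $\{a,b\}$ and $\{c,d\}$ are distinct if $\{a,b\}\neq\{c,d\}$. The graph $H$ has Laplacian perfect pair state transfer if there are two distinct pair states $\mathbf e_a-\mathbf e_b$ and $\mathbf e_c-\mathbf e_d$ of $H$, a time $\tau\in\mathbb{R}$ and a complex number $\chi$ with $|\chi|=1$ such that $$U_{L_H}(\tau)(\mathbf e_a-\mathbf e_b)=\chi(\mathbf e_c-\mathbf e_d).$$ The Q-graph $\mathcal Q(G)$ of a graph $G$ is obtained from $G$ by inserting a new vertex into each edge of $G$ (subdividing the edge), and joining by edges those pairs of new vertices which lie on adjacent edges of $G$. Theorem. Let $G$ be a finite simple connected $r$-regular graph. If $r+1=2^t$ for an integer $t\ge 2$, then $\mathcal Q(G)$ does not have Laplacian perfect pair state transfer. -/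

import Mathlib

/-- The Q-graph of `G`: a new vertex is inserted into each edge of `G` (so the original edges are
subdivided), and two new vertices are joined whenever they lie on adjacent edges of `G`, that is,
on distinct edges with a common end. The vertices are `V(G)` together with the edges of `G`. -/
def qGraph {V : Type*} (G : SimpleGraph V) : SimpleGraph (V ⊕ G.edgeSet) where
  Adj x y :=
    match x, y with
    | Sum.inl _, Sum.inl _ => False
    | Sum.inl v, Sum.inr e => v ∈ (e : Sym2 V)
    | Sum.inr e, Sum.inl v => v ∈ (e : Sym2 V)
    | Sum.inr e, Sum.inr f => e ≠ f ∧ ∃ v : V, v ∈ (e : Sym2 V) ∧ v ∈ (f : Sym2 V)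
  symm := by
    constructor
    rintro (v | e) (w | f) h
    · exact h
    · exact h
    · exact h
    · exact ⟨h.1.symm, h.2.imp fun _ hv => ⟨hv.2, hv.1⟩⟩
  loopless := by
    constructor
    rintro (v | e) h
    · exact h
    · exact h.1 rfl

noncomputable instance qGraph.instDecidableRelAdj {V : Type*} (G : SimpleGraph V) :
    DecidableRel (qGraph G).Adj :=
  Classical.decRel _

/-- The pair state `e_a - e_b` of a pair of vertices. -/
def pairState {W : Type*} [DecidableEq W] (a b : W) : W → ℂ :=
  Pi.single a 1 - Pi.single b 1

/-- The transition matrix `U(τ) = exp(-i τ L)` relative to the Laplacian matrix `L` of `H`. -/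
noncomputable def lapTransition {W : Type*} [Fintype W] [DecidableEq W]
    (H : SimpleGraph W) [DecidableRel H.Adj] (τ : ℝ) : Matrix W W ℂ :=
  NormedSpace.exp ((-(Complex.I * (τ : ℂ))) • H.lapMatrix ℂ)

/-- Laplacian perfect pair state transfer between the pair states of `{a, b}` and `{c, d}` at
time `τ`. A pair state belongs to an unordered pair of distinct vertices (`e_a - e_b` and
`e_b - e_a` are the same state up to a phase), and the two pair states must be distinct. -/
def PairLPSTAt {W : Type*} [Fintype W] [DecidableEq W]
    (H : SimpleGraph W) [DecidableRel H.Adj] (a b c d : W) (τ : ℝ) : Prop :=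
  a ≠ b ∧ c ≠ d ∧ s(a, b) ≠ s(c, d) ∧
    ∃ χ : ℂ, ‖χ‖ = 1 ∧ (lapTransition H τ).mulVec (pairState a b) = χ • pairState c d

/-- `H` has Laplacian perfect pair state transfer (between some two distinct pair states, at some
time). -/
def HasPairLPST {W : Type*} [Fintype W] [DecidableEq W]
    (H : SimpleGraph W) [DecidableRel H.Adj] : Prop :=
  ∃ (a b c d : W) (τ : ℝ), PairLPSTAt H a b c d τ

/-!
Let `R` be the vertex-edge incidence matrix of the `r`-regular graph `G` and `N = r + 1 = 2 ^ t`.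
Shifted by `N`, the Laplacian of the Q-graph becomes the block matrix
`M = [[-1, -R], [-Rᵀ, N - RᵀR]]` (`qShift`, `qGraph_lapMatrix`). An adjacency eigenvector `p` of
`G` with eigenvalue `a ≠ -r` gives eigenvectors `((r + a) p, -(ν + 1) Rᵀp)` of `M` for the two roots
of `ν² + a ν = N` (`qShift_mulVec_lift`), whose product is `-N`; the kernel of `R` belongs to the
eigenvalue `N`, and when `a = -r` the vector `(p, 0)` has eigenvalue `-1`. In a transfer from `x` to
`y` the components of `x` and `y` along a real eigenvector agree up to a phase
(`exists_transfers_of_pairLPSTAt`), which is a sign since both states are real. The proof goes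
through the kinds of the two pairs: both vertices original, both new, or mixed.

* Mixed pairs are the only ones with a component along the eigenvector `(r, -2)` with eigenvalue
  `1`, so they transfer only to each other. By `exists_ker_edgeInc_apply_ne_zero` the eigenvalue `N`
  occurs as well. Hence all eigenvalues that occur are rational, thus integers dividing `N`, thus
  even or `±1`, and the phase is constant on the even ones and on `±1`. If the two states differ,
  their sum lies in the eigenspaces of `±1`, which
  `not_forall_dotProduct_realPair_add_eq_zero` excludes.
* From a pair of original to a pair of new vertices (or back), comparing the sizes of the components
  shows that `e_a - e_b` is an adjacency eigenvector with eigenvalue `2`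
  (`not_abs_eq_vertex_edge`), which it is not.
* For two pairs of the same kind, put `u`, `v` for the two states if the vertices are original, and
  for their images under `R` if they are new. Both roots `ν` belonging to an adjacency eigenvalue
  `a ≠ -r` then act by the same sign. The arithmetical heart of the proof, `not_opposite_phase`, is
  that for `N` a power of two this sign cannot depend on `a`, so that `v - σ u` is annihilated by
  `Rᵀ` for a single sign `σ` (`exists_common_sign`). For original vertices `v - σ u` then alternates
  along edges, but its support is too small. For new vertices it means that the states differ by `σ`
  up to the kernel of `R`, where the sign has to be `-σ`. Then the time is a rational multiple of
  `π` (`exists_rat_time`), and `add_eq_zero_of_opposite_phase` shows that only the adjacency eigenvalue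
  `0` occurs, so that the coordinates of the states would satisfy an identity contradicting that
  `r ≥ 3` is odd.
-/

open Matrix

set_option linter.unusedSectionVars false

/-! ### Arithmetic of integral numbers with product `-2 ^ t` -/

theorem exists_int_of_isIntegral_of_rat {x : ℝ} (hx : IsIntegral ℤ x) {q : ℚ} (hq : x = q) :
    ∃ n : ℤ, x = n := by
  subst hq
  have h : IsIntegral ℤ q := by
    have := (isIntegral_algebraMap_iff (R := ℤ) (A := ℚ) (B := ℝ)
      (algebraMap ℚ ℝ).injective (x := q)).1 (by simpa using hx)
    exact this
  obtain ⟨n, hn⟩ := (IsIntegrallyClosed.isIntegral_iff (R := ℤ) (K := ℚ)).1 h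
  exact ⟨n, by rw [← hn]; simp⟩

theorem isIntegral_of_sq_add_mul_eq {α ν : ℝ} {N : ℤ} (hα : IsIntegral ℤ α)
    (h : ν ^ 2 + α * ν = N) : IsIntegral ℤ ν := by
  let a : integralClosure ℤ ℝ := ⟨α, hα⟩
  have key : IsIntegral (integralClosure ℤ ℝ) ν := by
    refine ⟨Polynomial.X ^ 2 + Polynomial.C a * Polynomial.X +
      Polynomial.C (algebraMap ℤ (integralClosure ℤ ℝ) (-N)), ?_, ?_⟩
    · monicity!
    · have : algebraMap (integralClosure ℤ ℝ) ℝ a = α := rfl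
      have hN : algebraMap (integralClosure ℤ ℝ) ℝ
          (algebraMap ℤ (integralClosure ℤ ℝ) (-N)) = -N := by
        rw [← IsScalarTower.algebraMap_apply]; simp
      simp only [Polynomial.eval₂_add, Polynomial.eval₂_mul, Polynomial.eval₂_pow,
        Polynomial.eval₂_X, Polynomial.eval₂_C, this, hN]
      linarith
  exact isIntegral_trans (R := ℤ) (A := integralClosure ℤ ℝ) ν key

theorem add_eq_zero_of_mul_eq_neg_two_pow {t : ℕ} {x y : ℝ} (hx : IsIntegral ℤ x)
    (hy : IsIntegral ℤ y) (hxy : x * y = -2 ^ t) {P Q : ℤ} (hP : Odd P) (hQ : Odd Q)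
    (h : x * Q = y * P) : x + y = 0 := by
  have hx0 : x ≠ 0 := by rintro rfl; simp at hxy
  have hP0 : (P : ℝ) ≠ 0 := by
    intro h; have : P = 0 := by exact_mod_cast h
    subst this; simp at hP
  have hQ0 : (Q : ℝ) ≠ 0 := by
    intro h; have : Q = 0 := by exact_mod_cast h
    subst this; simp at hQ
  have hx2 : x ^ 2 * Q = -2 ^ t * P := by
    rw [← hxy]; linear_combination x * h
  have hy2 : y ^ 2 * P = -2 ^ t * Q := by
    rw [← hxy]; linear_combination (-y) * h
  obtain ⟨n, hn⟩ := exists_int_of_isIntegral_of_rat (hx.pow 2) (q := -2 ^ t * P / Q) (by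
    push_cast; rw [eq_div_iff hQ0, hx2])
  obtain ⟨m, hm⟩ := exists_int_of_isIntegral_of_rat (hy.pow 2) (q := -2 ^ t * Q / P) (by
    push_cast; rw [eq_div_iff hP0, hy2])
  have hnm : n * m = 2 ^ (2 * t) := by
    have : (n : ℝ) * m = 2 ^ (2 * t) := by
      rw [← hn, ← hm, ← mul_pow, hxy, neg_sq, ← pow_mul, mul_comm]
    exact_mod_cast this
  have hnpos : 0 < n := by
    have : (0 : ℝ) < n := by rw [← hn]; positivity
    exact_mod_cast this
  have hnQ : n * Q = -2 ^ t * P := by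
    rw [hn] at hx2; exact_mod_cast hx2
  -- `n` divides a power of two and is its own odd part times `2 ^ t`, hence equals `2 ^ t`
  have hcop : ∀ {z : ℤ}, Odd z → ∀ k : ℕ, IsCoprime ((2 : ℤ) ^ k) z := fun hz k => by
    refine IsCoprime.pow_left ?_
    obtain ⟨w, rfl⟩ := hz
    exact ⟨-w, 1, by ring⟩
  have h1 : (2 : ℤ) ^ t ∣ n :=
    (hcop hQ t).dvd_of_dvd_mul_right (by rw [hnQ]; exact ⟨-P, by ring⟩)
  have hnP : IsCoprime n P := (hcop hP (2 * t)).of_isCoprime_of_dvd_left ⟨m, hnm.symm⟩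
  have h2 : n ∣ 2 ^ t := hnP.dvd_of_dvd_mul_right ⟨-Q, by linarith⟩
  have hnt : n = 2 ^ t := Int.dvd_antisymm hnpos.le (by positivity) h2 h1
  have hx2' : x ^ 2 = 2 ^ t := by rw [hn, hnt]; push_cast; rfl
  have : x * (x + y) = 0 := by linear_combination hx2' + hxy
  exact (mul_eq_zero.1 this).resolve_left hx0

/-- Two pairs of eigenvalues with product `-2 ^ t` whose members are kept in phase within each pair
cannot be in opposite phase to each other: `X₁`, which is the eigenvalue `x₁` in units of `π / τ`,
would be a quotient of an odd by an even integer, so that `X₁` and `X₂ = X₁ - 2m` have the same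
`2`-adic valuation; this forces `x₁ = -x₂`, and then `X₁ = m` is an integer. -/
theorem not_opposite_phase {t : ℕ} {ρ x₁ x₂ y₁ y₂ : ℝ} (hx₁ : IsIntegral ℤ x₁)
    (hx₂ : IsIntegral ℤ x₂) (hx : x₁ * x₂ = -2 ^ t) (hy : y₁ * y₂ = -2 ^ t) {m n l : ℤ}
    (hm : ρ * (x₁ - x₂) = 2 * m) (hn : ρ * (y₁ - y₂) = 2 * n)
    (hl : ρ * (x₁ - y₁) = 2 * l + 1) : False := by
  have hρ : ρ ≠ 0 := by
    rintro rfl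
    rw [zero_mul] at hl
    have : (0 : ℤ) = 2 * l + 1 := by exact_mod_cast hl
    omega
  set A : ℤ := 2 * (2 * l + 1 + n - m) with hA
  set B : ℤ := (2 * l + 1) * (2 * l + 1 + 2 * n) with hB
  have hAB : ρ * x₁ * A = B := by
    have h1 : ρ * x₂ = ρ * x₁ - 2 * m := by linarith
    have h2 : ρ * y₁ = ρ * x₁ - (2 * l + 1) := by linarith
    have h3 : ρ * y₂ = ρ * x₁ - (2 * l + 1) - 2 * n := by linarith
    have h4 : (ρ * x₁) * (ρ * x₂) = (ρ * y₁) * (ρ * y₂) := by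
      linear_combination ρ ^ 2 * hx - ρ ^ 2 * hy
    rw [h1, h2, h3] at h4
    rw [hA, hB]; push_cast
    linear_combination h4
  have hBo : Odd B := by
    rw [hB]; exact Odd.mul ⟨l, rfl⟩ ⟨l + n, by ring⟩
  have hCo : Odd (B - 2 * m * A) := by
    refine hBo.sub_even ⟨m * A, by ring⟩
  have hsum := add_eq_zero_of_mul_eq_neg_two_pow hx₁ hx₂ hx hBo hCo (by
    have : ρ * x₂ * A = B - 2 * m * A := by linear_combination hAB - A * hm
    apply mul_left_cancel₀ hρ
    push_cast
    rw [← this, ← hAB]; ring)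
  have h5 : ρ * x₁ = m := by
    have : x₂ = -x₁ := by linarith
    rw [this] at hm; linarith
  rw [h5] at hAB
  have : m * A = B := by exact_mod_cast hAB
  rw [← this, hA] at hBo
  exact (Int.not_even_iff_odd.2 hBo) ⟨m * (2 * l + 1 + n - m), by ring⟩

/-- If both members of a pair with product `-2 ^ t` are in opposite phase to the eigenvalue `2 ^ t`,
at a time which is a rational multiple of `π`, then the pair is symmetric about `0`. -/
theorem add_eq_zero_of_opposite_phase {t : ℕ} (ht : t ≠ 0) {x y : ℝ} {ρ : ℚ}
    (hx : IsIntegral ℤ x) (hy : IsIntegral ℤ y) (hxy : x * y = -2 ^ t) {l m : ℤ}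
    (hl : ρ * (2 ^ t - x) = 2 * l + 1) (hm : ρ * (2 ^ t - y) = 2 * m + 1) : x + y = 0 := by
  obtain ⟨s, rfl⟩ := Nat.exists_eq_add_one_of_ne_zero ht
  set a : ℤ := (ρ * 2 ^ (s + 1)).num with ha
  set b : ℤ := ((ρ * 2 ^ (s + 1)).den : ℤ) with hb
  have hb0 : (b : ℝ) ≠ 0 := by rw [hb]; exact_mod_cast (ρ * 2 ^ (s + 1)).den_nz
  have hY : (ρ : ℝ) * 2 ^ (s + 1) * b = a := by
    have := Rat.mul_den_eq_num (ρ * 2 ^ (s + 1))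
    rw [hb, ha]; exact_mod_cast this
  have hρ : (ρ : ℝ) ≠ 0 := by
    intro h
    rw [h, zero_mul] at hl
    have : (0 : ℤ) = 2 * l + 1 := by exact_mod_cast hl
    omega
  have hX : ρ * x * b = a - (2 * l + 1) * b := by linear_combination hY - b * hl
  have hX' : ρ * y * b = a - (2 * m + 1) * b := by linear_combination hY - b * hm
  have hquad : 2 ^ (s + 1) * ((a - (2 * l + 1) * b) * (a - (2 * m + 1) * b)) = - a ^ 2 := by
    have : (2 : ℝ) ^ (s + 1) * ((a - (2 * l + 1) * b) * (a - (2 * m + 1) * b)) = - a ^ 2 := by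
      rw [← hX, ← hX', ← hY]
      linear_combination 2 ^ (s + 1) * ρ ^ 2 * b ^ 2 * hxy
    exact_mod_cast this
  have hae : Even a := by
    have : Even (a ^ 2) := by
      rw [← even_neg, ← hquad]
      exact Even.mul_right ⟨2 ^ s, by ring⟩ _
    exact (Int.even_pow.1 this).1
  have hbo : Odd b := by
    rw [← Int.not_even_iff_odd]
    intro hbe
    have hc : IsCoprime a b := by
      rw [hb, ha, Int.isCoprime_iff_gcd_eq_one]
      simpa [Int.gcd] using (ρ * 2 ^ (s + 1)).reduced
    exact absurd (hc.isUnit_of_dvd' hae.two_dvd hbe.two_dvd) (by decide)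
  refine add_eq_zero_of_mul_eq_neg_two_pow hx hy hxy
    (hae.sub_odd (Odd.mul ⟨l, rfl⟩ hbo)) (hae.sub_odd (Odd.mul ⟨m, rfl⟩ hbo)) ?_
  apply mul_left_cancel₀ hρ
  apply mul_left_cancel₀ hb0
  push_cast
  linear_combination (ρ * x * b) * (-1 : ℝ) * hX' + (ρ * y * b) * hX

/-! ### Symmetric matrices and their eigenvectors -/

theorem dotProduct_mulVec_of_eigenvector {W : Type*} [Fintype W] {B : Matrix W W ℝ}
    (hB : B.IsSymm) {ν : ℝ} {z : W → ℝ} (hz : B *ᵥ z = ν • z) (h : W → ℝ) :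
    z ⬝ᵥ (B *ᵥ h) = ν * (z ⬝ᵥ h) := by
  rw [dotProduct_mulVec, ← mulVec_transpose, hB.eq, hz, smul_dotProduct, smul_eq_mul]

section LinearAlgebra

variable {W : Type*} [Fintype W] [DecidableEq W]

theorem isIntegral_of_mulVec_eq (B : Matrix W W ℤ) {ν : ℝ} {z : W → ℝ} (hz : z ≠ 0)
    (h : B.map (fun n : ℤ => (n : ℝ)) *ᵥ z = ν • z) : IsIntegral ℤ ν := by
  refine ⟨B.charpoly, B.charpoly_monic, ?_⟩
  have hev : Module.End.HasEigenvalue (Matrix.toLin' (B.map (fun n : ℤ => (n : ℝ)))) ν :=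
    Module.End.hasEigenvalue_of_hasEigenvector (x := z)
      ⟨Module.End.mem_eigenspace_iff.2 (by simpa using h), hz⟩
  have h2 := Module.End.hasEigenvalue_iff_isRoot_charpoly _ _ |>.1 hev
  rw [Matrix.charpoly_toLin'] at h2
  have h3 : (B.map (fun n : ℤ => (n : ℝ))).charpoly = B.charpoly.map (Int.castRingHom ℝ) :=
    Matrix.charpoly_map B (Int.castRingHom ℝ)
  rw [h3, Polynomial.IsRoot, Polynomial.eval_map] at h2
  exact h2

theorem eq_zero_of_forall_eigenvector {B : Matrix W W ℝ} (hB : B.IsSymm) {h : W → ℝ}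
    (H : ∀ (ν : ℝ) (z : W → ℝ), B *ᵥ z = ν • z → z ⬝ᵥ h = 0) : h = 0 := by
  have hH : B.IsHermitian := by
    rw [Matrix.IsHermitian, Matrix.conjTranspose_eq_transpose_of_trivial]; exact hB
  have key : WithLp.toLp 2 h = 0 := by
    refine InnerProductSpace.ext_inner_left_basis (𝕜 := ℝ) hH.eigenvectorBasis.toBasis fun i => ?_
    have := H _ _ (hH.mulVec_eigenvectorBasis i)
    simpa [EuclideanSpace.inner_eq_star_dotProduct, dotProduct_comm] using this
  simpa using congrArg (WithLp.ofLp) key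

theorem exp_mulVec_of_eigenvector {B : Matrix W W ℂ} {c : ℂ} {z : W → ℂ} (h : B *ᵥ z = c • z) :
    NormedSpace.exp B *ᵥ z = Complex.exp c • z := by
  let : SeminormedRing (Matrix W W ℂ) := Matrix.linftyOpSemiNormedRing
  let : NormedRing (Matrix W W ℂ) := Matrix.linftyOpNormedRing
  let : NormedAlgebra ℂ (Matrix W W ℂ) := Matrix.linftyOpNormedAlgebra
  have hpow : ∀ n : ℕ, B ^ n *ᵥ z = c ^ n • z := fun n => by
    induction n with
    | zero => simp
    | succ n ih => rw [pow_succ, ← mulVec_mulVec, h, mulVec_smul, ih, smul_smul, pow_succ, mul_comm]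
  have h1 := NormedSpace.exp_series_hasSum_exp' (𝕂 := ℂ) B
  have h2 : HasSum (fun n : ℕ => ((n.factorial : ℂ)⁻¹ • B ^ n) *ᵥ z) (NormedSpace.exp B *ᵥ z) :=
    h1.map ((Matrix.mulVecBilin ℂ ℂ).flip z).toAddMonoidHom
      (by exact (continuous_id.matrix_mulVec continuous_const))
  have h3 : HasSum (fun n : ℕ => ((n.factorial : ℂ)⁻¹ • c ^ n) • z) (NormedSpace.exp c • z) :=
    (NormedSpace.exp_series_hasSum_exp' (𝕂 := ℂ) c).smul_const z
  rw [Complex.exp_eq_exp_ℂ]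
  refine h2.unique ?_
  convert h3 using 2 with n
  rw [smul_mulVec, hpow, smul_smul, smul_eq_mul]

end LinearAlgebra

/-! ### The Laplacian of the Q-graph in terms of the incidence matrix -/

section Incidence

variable {V : Type*} [Fintype V] [DecidableEq V] (G : SimpleGraph V) [DecidableRel G.Adj]

/-- The vertex-edge incidence matrix `R` of `G`, with columns indexed by the edges only (unlike
`SimpleGraph.incMatrix`, which has a column for every element of `Sym2 V`). -/
def edgeInc (α : Type*) [Zero α] [One α] : Matrix V G.edgeSet α :=
  .of fun v e => if v ∈ (e : Sym2 V) then 1 else 0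

variable {α : Type*} [CommRing α]

theorem edgeInc_apply (v : V) (e : G.edgeSet) :
    edgeInc G α v e = if v ∈ (e : Sym2 V) then 1 else 0 := rfl

theorem edgeInc_eq_incMatrix (v : V) (e : G.edgeSet) :
    edgeInc G α v e = G.incMatrix α v (e : Sym2 V) := by
  simp [edgeInc_apply, SimpleGraph.incMatrix_apply', SimpleGraph.incidenceSet]

theorem sum_edgeSet_incMatrix_mul (v : V) (g : Sym2 V → α) :
    ∑ e : G.edgeSet, edgeInc G α v e * g e = ∑ e, G.incMatrix α v e * g e := by
  refine Fintype.sum_of_injective Subtype.val Subtype.val_injective _ _ (fun e he => ?_)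
    (fun e => by rw [edgeInc_eq_incMatrix])
  rw [G.incMatrix_of_notMem_incidenceSet, zero_mul]
  exact fun h => he ⟨⟨e, h.1⟩, rfl⟩

theorem edgeInc_mul_transpose {r : ℕ} (hreg : G.IsRegularOfDegree r) :
    edgeInc G α * (edgeInc G α)ᵀ = G.adjMatrix α + (r : α) • 1 := by
  ext v w
  have h1 : (edgeInc G α * (edgeInc G α)ᵀ) v w = (G.incMatrix α * (G.incMatrix α)ᵀ) v w := by
    rw [Matrix.mul_apply, Matrix.mul_apply, ← sum_edgeSet_incMatrix_mul]
    simp only [transpose_apply, edgeInc_eq_incMatrix]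
  rw [h1, SimpleGraph.incMatrix_mul_transpose]
  by_cases hvw : v = w
  · subst hvw; simp [hreg.degree_eq v]
  · simp [hvw, SimpleGraph.adjMatrix_apply]

theorem sum_edgeInc_row {r : ℕ} (hreg : G.IsRegularOfDegree r) (v : V) :
    ∑ e, edgeInc G α v e = r := by
  have := sum_edgeSet_incMatrix_mul (α := α) G v (fun _ => 1)
  simp only [mul_one] at this
  rw [this, SimpleGraph.sum_incMatrix_apply, hreg.degree_eq v]

theorem sum_edgeInc_col (e : G.edgeSet) : ∑ v, edgeInc G α v e = 2 := by
  simp only [edgeInc_eq_incMatrix]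
  exact G.sum_incMatrix_apply_of_mem_edgeSet e.2

theorem edgeInc_transpose_mul_apply (e f : G.edgeSet) :
    ((edgeInc G α)ᵀ * edgeInc G α) e f =
      if e = f then 2 else if ∃ v : V, v ∈ (e : Sym2 V) ∧ v ∈ (f : Sym2 V) then 1 else 0 := by
  have h0 : ((edgeInc G α)ᵀ * edgeInc G α) e f =
      ∑ v, if v ∈ (e : Sym2 V) ∧ v ∈ (f : Sym2 V) then (1 : α) else 0 := by
    simp only [Matrix.mul_apply, transpose_apply, edgeInc_apply, ite_zero_mul_ite_zero, one_mul]
  rw [h0]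
  split_ifs with h1 h2
  · subst h1
    rw [← sum_edgeInc_col G e]
    simp [edgeInc_apply]
  · obtain ⟨v, hv⟩ := h2
    rw [Finset.sum_eq_single v, if_pos hv]
    · rintro w - hw
      refine if_neg fun hw' => h1 (Subtype.ext ?_)
      exact Sym2.eq_of_ne_mem hw hw'.1 hv.1 hw'.2 hv.2
    · simp
  · exact Finset.sum_eq_zero fun v _ => if_neg fun hv => h2 ⟨v, hv⟩

theorem qGraph_adjMatrix :
    (qGraph G).adjMatrix α = fromBlocks 0 (edgeInc G α) (edgeInc G α)ᵀ
      ((edgeInc G α)ᵀ * edgeInc G α - (2 : α) • 1) := by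
  ext (v | e) (w | f)
  · rw [SimpleGraph.adjMatrix_apply]; simp [qGraph]
  · rw [SimpleGraph.adjMatrix_apply]
    by_cases h : v ∈ (f : Sym2 V) <;> simp [qGraph, edgeInc_apply, h]
  · rw [SimpleGraph.adjMatrix_apply]
    by_cases h : w ∈ (e : Sym2 V) <;> simp [qGraph, edgeInc_apply, h]
  · rw [fromBlocks_apply₂₂, Matrix.sub_apply, edgeInc_transpose_mul_apply, Matrix.smul_apply,
      Matrix.one_apply, SimpleGraph.adjMatrix_apply]
    by_cases h : e = f
    · simp [h]
    · simp [qGraph, h]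

/-- The Laplacian matrix of the Q-graph of an `r`-regular graph, shifted by `r + 1`. The shift
makes the eigenvalues come in pairs with product `-(r + 1)`. -/
def qShift (α : Type*) [CommRing α] (r : ℕ) : Matrix (V ⊕ G.edgeSet) (V ⊕ G.edgeSet) α :=
  fromBlocks (-1) (-edgeInc G α) (-(edgeInc G α)ᵀ)
    ((r + 1 : α) • 1 - (edgeInc G α)ᵀ * edgeInc G α)

/-- The integral matrix whose product with `qShift` is `r + 1`. -/
def qCoshift (α : Type*) [CommRing α] : Matrix (V ⊕ G.edgeSet) (V ⊕ G.edgeSet) α :=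
  fromBlocks (G.adjMatrix α - 1) (-edgeInc G α) (-(edgeInc G α)ᵀ) 1

theorem qGraph_lapMatrix {r : ℕ} (hreg : G.IsRegularOfDegree r) :
    (qGraph G).lapMatrix α = qShift G α r + (r + 1 : α) • 1 := by
  have hdeg : ∀ x, ((qGraph G).degree x : α) = ∑ y, (qGraph G).adjMatrix α x y := fun x => by
    rw [SimpleGraph.degree_eq_sum_if_adj]; simp [SimpleGraph.adjMatrix_apply]
  have hv : ∀ v : V, ((qGraph G).degree (Sum.inl v) : α) = r := fun v => by
    rw [hdeg, qGraph_adjMatrix, Fintype.sum_sum_type]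
    simp [sum_edgeInc_row G hreg]
  have he : ∀ e : G.edgeSet, ((qGraph G).degree (Sum.inr e) : α) = 2 * r := fun e => by
    rw [hdeg, qGraph_adjMatrix, Fintype.sum_sum_type]
    simp only [fromBlocks_apply₂₁, fromBlocks_apply₂₂, transpose_apply, sum_edgeInc_col,
      Matrix.sub_apply, Matrix.smul_apply, Finset.sum_sub_distrib, Matrix.mul_apply]
    rw [Finset.sum_comm]
    simp only [← Finset.mul_sum, sum_edgeInc_row G hreg, ← Finset.sum_mul, sum_edgeInc_col]
    simp [Matrix.one_apply]
  rw [SimpleGraph.lapMatrix, qGraph_adjMatrix]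
  ext (v | e) (w | f)
  · by_cases h : v = w
    · subst h; simp [SimpleGraph.degMatrix, qShift, hv]
    · simp [SimpleGraph.degMatrix, qShift, h]
  · simp [SimpleGraph.degMatrix, qShift]
  · simp [SimpleGraph.degMatrix, qShift]
  · by_cases h : e = f
    · subst h; simp [SimpleGraph.degMatrix, qShift, he]; ring
    · simp [SimpleGraph.degMatrix, qShift, h]

theorem qShift_isSymm (r : ℕ) : (qShift G α r).IsSymm := by
  rw [Matrix.IsSymm, qShift, fromBlocks_transpose]
  simp

theorem qCoshift_mul_qShift {r : ℕ} (hreg : G.IsRegularOfDegree r) :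
    qCoshift G α * qShift G α r = (r + 1 : α) • 1 := by
  have hR := edgeInc_mul_transpose (α := α) G hreg
  rw [qCoshift, qShift, fromBlocks_multiply, ← fromBlocks_one, fromBlocks_smul]
  congr 1
  · rw [Matrix.mul_neg, Matrix.mul_one, Matrix.neg_mul, Matrix.mul_neg, neg_neg, hR, add_smul,
      one_smul]
    abel
  · rw [smul_zero, Matrix.neg_mul, Matrix.mul_sub, ← Matrix.mul_assoc, hR, Matrix.mul_neg,
      Matrix.sub_mul, Matrix.add_mul, Matrix.smul_mul, Matrix.mul_smul, Matrix.mul_one,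
      Matrix.one_mul, add_smul, one_smul]
    abel
  · simp
  · simp

theorem qShift_map {β : Type*} [CommRing β] (φ : α →+* β) (r : ℕ) :
    (qShift G α r).map φ = qShift G β r := by
  have hR : (edgeInc G α).map φ = edgeInc G β := by
    ext v e; simp [edgeInc_apply, apply_ite φ]
  rw [qShift, qShift, fromBlocks_map, ← hR, ← Matrix.transpose_map, ← Matrix.map_mul]
  congr 1
  · ext; simp [Matrix.one_apply, apply_ite φ]
  · ext; simp
  · ext; simp
  · ext i j; by_cases h : i = j <;> simp [-Matrix.map_mul, h]

theorem qCoshift_map {β : Type*} [CommRing β] (φ : α →+* β) :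
    (qCoshift G α).map φ = qCoshift G β := by
  ext (v | e) (w | f) <;>
    simp [qCoshift, edgeInc_apply, apply_ite φ, Matrix.one_apply, SimpleGraph.adjMatrix_apply]

end Incidence

/-! ### Eigenvectors of the shifted Laplacian -/

section Eigenvectors

variable {V : Type*} [Fintype V] [DecidableEq V] (G : SimpleGraph V) [DecidableRel G.Adj]

theorem qShift_mulVec (r : ℕ) (p : V → ℝ) (g : G.edgeSet → ℝ) :
    qShift G ℝ r *ᵥ Sum.elim p g =
      Sum.elim (-p - edgeInc G ℝ *ᵥ g)
        (-((edgeInc G ℝ)ᵀ *ᵥ p) + (r + 1 : ℝ) • g - (edgeInc G ℝ)ᵀ *ᵥ (edgeInc G ℝ *ᵥ g)) := by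
  rw [qShift, fromBlocks_mulVec]
  congr 1
  · simp only [Sum.elim_comp_inl, Sum.elim_comp_inr, neg_mulVec, one_mulVec]; abel
  · simp only [Sum.elim_comp_inl, Sum.elim_comp_inr, neg_mulVec, sub_mulVec, smul_mulVec,
      one_mulVec, mulVec_mulVec]; abel

theorem edgeInc_mulVec_transpose_mulVec {r : ℕ} (hreg : G.IsRegularOfDegree r) (p : V → ℝ) :
    edgeInc G ℝ *ᵥ ((edgeInc G ℝ)ᵀ *ᵥ p) = G.adjMatrix ℝ *ᵥ p + (r : ℝ) • p := by
  rw [mulVec_mulVec, edgeInc_mul_transpose G hreg, add_mulVec, smul_mulVec, one_mulVec]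

/-- Each eigenvector `p` of the adjacency matrix, with eigenvalue `a`, gives eigenvectors of the
shifted Laplacian for the two roots of `ν² + a ν = r + 1`. They vanish when `a = -r`. -/
theorem qShift_mulVec_lift {r : ℕ} (hreg : G.IsRegularOfDegree r) {a ν : ℝ} {p : V → ℝ}
    (hp : G.adjMatrix ℝ *ᵥ p = a • p) (hν : ν ^ 2 + a * ν = r + 1) :
    qShift G ℝ r *ᵥ Sum.elim ((r + a) • p) ((-(ν + 1)) • ((edgeInc G ℝ)ᵀ *ᵥ p)) =
      ν • Sum.elim ((r + a) • p) ((-(ν + 1)) • ((edgeInc G ℝ)ᵀ *ᵥ p)) := by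
  rw [qShift_mulVec]
  have h1 : edgeInc G ℝ *ᵥ ((-(ν + 1)) • ((edgeInc G ℝ)ᵀ *ᵥ p)) = (-(ν + 1) * (a + r)) • p := by
    rw [mulVec_smul, edgeInc_mulVec_transpose_mulVec G hreg, hp, ← add_smul, smul_smul]
  rw [h1]
  ext (v | e)
  · simp; ring
  · simp only [mulVec_smul, Sum.elim_inr, Pi.sub_apply, Pi.add_apply, Pi.neg_apply, Pi.smul_apply,
      smul_eq_mul]
    linear_combination ((edgeInc G ℝ)ᵀ *ᵥ p) e * hν

theorem qShift_mulVec_of_ker {r : ℕ} {g : G.edgeSet → ℝ} (hg : edgeInc G ℝ *ᵥ g = 0) :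
    qShift G ℝ r *ᵥ Sum.elim (0 : V → ℝ) g = (r + 1 : ℝ) • Sum.elim (0 : V → ℝ) g := by
  rw [qShift_mulVec, hg]
  ext (v | e) <;> simp

theorem qShift_mulVec_of_transpose_ker {r : ℕ} {p : V → ℝ} (hp : (edgeInc G ℝ)ᵀ *ᵥ p = 0) :
    qShift G ℝ r *ᵥ Sum.elim p 0 = (-1 : ℝ) • Sum.elim p 0 := by
  rw [qShift_mulVec, hp]
  ext (v | e) <;> simp

theorem edgeInc_transpose_mulVec_apply {α : Type*} [CommRing α] (p : V → α) {v w : V}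
    (h : G.Adj v w) : ((edgeInc G α)ᵀ *ᵥ p) ⟨s(v, w), h⟩ = p v + p w := by
  have : ∀ u, edgeInc G α u ⟨s(v, w), h⟩ * p u =
      (if u = v then p u else 0) + (if u = w then p u else 0) := fun u => by
    rw [edgeInc_apply]
    by_cases h1 : u = v
    · subst h1; simp [h.ne]
    · by_cases h2 : u = w
      · subst h2; simp [h1]
      · simp [h1, h2]
  simp only [mulVec, dotProduct, transpose_apply, this, Finset.sum_add_distrib]
  simp

theorem qShift_mulVec_const {r : ℕ} (hreg : G.IsRegularOfDegree r) :
    qShift G ℝ r *ᵥ Sum.elim (fun _ => (r : ℝ)) (fun _ => -2) =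
      (1 : ℝ) • Sum.elim (fun _ => (r : ℝ)) (fun _ => -2) := by
  have h1 : edgeInc G ℝ *ᵥ (fun _ => (-2 : ℝ)) = fun _ => -2 * (r : ℝ) := by
    ext v
    simp only [mulVec, dotProduct, ← Finset.sum_mul, sum_edgeInc_row G hreg]; ring
  have h2 : ∀ c : ℝ, (edgeInc G ℝ)ᵀ *ᵥ (fun _ => c) = fun _ => 2 * c := fun c => by
    ext e
    simp only [mulVec, dotProduct, transpose_apply, ← Finset.sum_mul, sum_edgeInc_col G]
  rw [qShift_mulVec, h1, h2, h2]
  ext (v | e)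
  · simp; ring
  · simp; ring

theorem isIntegral_of_adjMatrix_eigenvector {a : ℝ} {p : V → ℝ} (h0 : p ≠ 0)
    (hp : G.adjMatrix ℝ *ᵥ p = a • p) : IsIntegral ℤ a := by
  refine isIntegral_of_mulVec_eq (G.adjMatrix ℤ) h0 ?_
  rw [← hp]
  congr 1
  ext v w; simp [SimpleGraph.adjMatrix_apply]

theorem edgeInc_transpose_mulVec_eq_zero {r : ℕ} (hreg : G.IsRegularOfDegree r) {p : V → ℝ}
    (hp : G.adjMatrix ℝ *ᵥ p = (-(r : ℝ)) • p) : (edgeInc G ℝ)ᵀ *ᵥ p = 0 := by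
  have h1 : edgeInc G ℝ *ᵥ ((edgeInc G ℝ)ᵀ *ᵥ p) = 0 := by
    rw [edgeInc_mulVec_transpose_mulVec G hreg, hp, ← add_smul]; simp
  rw [← dotProduct_self_eq_zero, dotProduct_mulVec, ← mulVec_transpose, transpose_transpose,
    h1, zero_dotProduct]

end Eigenvectors

/-! ### Phases and transfer in terms of real eigenvectors -/

/-- The phase, up to a constant `κ`, by which an eigenvector with eigenvalue `ν` is multiplied at
time `τ`. -/
noncomputable def phase (κ : ℂ) (τ ν : ℝ) : ℂ :=
  κ * Complex.exp (-(Complex.I * τ) * ν)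

theorem norm_phase {κ : ℂ} (hκ : ‖κ‖ = 1) (τ ν : ℝ) : ‖phase κ τ ν‖ = 1 := by
  have : -(Complex.I * τ) * ν = ((-(τ * ν) : ℝ) : ℂ) * Complex.I := by push_cast; ring
  rw [phase, norm_mul, hκ, this, Complex.norm_exp_ofReal_mul_I, one_mul]

theorem phase_eq_phase_iff {κ : ℂ} (hκ : ‖κ‖ = 1) {τ ν ν' : ℝ} :
    phase κ τ ν = phase κ τ ν' ↔ ∃ m : ℤ, τ / Real.pi * (ν - ν') = 2 * m := by
  have hκ0 : κ ≠ 0 := by rintro rfl; simp at hκ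
  have hpi := Real.pi_ne_zero
  rw [phase, phase, mul_right_inj' hκ0, Complex.exp_eq_exp_iff_exists_int]
  have key : ∀ m : ℤ,
      (-(Complex.I * τ) * ν = -(Complex.I * τ) * ν' + m * (2 * Real.pi * Complex.I)) ↔
      τ / Real.pi * (ν - ν') = 2 * (-m : ℤ) := fun m => by
    have h1 : (-(Complex.I * τ) * ν = -(Complex.I * τ) * ν' + m * (2 * Real.pi * Complex.I)) ↔
        (τ * (ν - ν') : ℂ) = -(2 * m * Real.pi) := by
      rw [← mul_right_inj' Complex.I_ne_zero (b := (τ * (ν - ν') : ℂ))]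
      constructor <;> intro h <;> linear_combination -h
    rw [h1, div_mul_eq_mul_div, div_eq_iff hpi]
    push_cast
    constructor
    · intro h
      have : τ * (ν - ν') = -(2 * m * Real.pi) := by exact_mod_cast h
      rw [this]; ring
    · intro h
      have h' : τ * (ν - ν') = -(2 * m * Real.pi) := by rw [h]; ring
      exact_mod_cast h'
  simp only [key]
  exact ⟨fun ⟨m, hm⟩ => ⟨-m, hm⟩, fun ⟨m, hm⟩ => ⟨-m, by rw [hm, neg_neg]⟩⟩

theorem exists_odd_of_phase_eq_neg {κ : ℂ} (hκ : ‖κ‖ = 1) {τ ν ν' : ℝ}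
    (h : phase κ τ ν = -phase κ τ ν') : ∃ m : ℤ, τ / Real.pi * (ν - ν') = 2 * m + 1 := by
  have hτ : τ ≠ 0 := by
    rintro rfl
    have hκ0 : κ ≠ 0 := by rintro rfl; simp at hκ
    simp only [phase, Complex.ofReal_zero, mul_zero, neg_zero, zero_mul, Complex.exp_zero,
      mul_one] at h
    exact hκ0 (self_eq_neg.1 h)
  have hpi := Real.pi_ne_zero
  -- moving the eigenvalue by `π / τ` changes the sign of the phase
  have h2 : -phase κ τ ν' = phase κ τ (ν' + Real.pi / τ) := by
    have : -(Complex.I * τ) * ((ν' + Real.pi / τ : ℝ) : ℂ) =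
        -(Complex.I * τ) * ν' - Real.pi * Complex.I := by
      have : (τ : ℂ) ≠ 0 := by exact_mod_cast hτ
      push_cast; field_simp; ring
    rw [phase, phase, this, Complex.exp_sub, Complex.exp_pi_mul_I]
    ring
  rw [h2, phase_eq_phase_iff hκ] at h
  obtain ⟨m, hm⟩ := h
  refine ⟨m, ?_⟩
  rw [← hm]; field_simp; ring

theorem exists_int_of_phase_eq_sign {κ : ℂ} (hκ : ‖κ‖ = 1) {τ ν ν' s s' : ℝ}
    (hs : s = 1 ∨ s = -1) (hs' : s' = 1 ∨ s' = -1) (h : phase κ τ ν = s)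
    (h' : phase κ τ ν' = s') : ∃ m : ℤ, τ / Real.pi * (ν - ν') = m := by
  by_cases hss : s = s'
  · obtain ⟨m, hm⟩ := (phase_eq_phase_iff hκ).1 (h.trans (by rw [hss, h']))
    exact ⟨2 * m, by rw [hm]; push_cast; ring⟩
  · have : s = -s' := by rcases hs with rfl | rfl <;> rcases hs' with rfl | rfl <;> simp_all
    obtain ⟨m, hm⟩ := exists_odd_of_phase_eq_neg hκ (h.trans (by rw [this, h']; push_cast; rfl))
    exact ⟨2 * m + 1, by rw [hm]; push_cast; ring⟩

/-- A phase relating two real numbers is a sign. -/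
theorem exists_sign_of_eq_phase_mul {κ : ℂ} (hκ : ‖κ‖ = 1) {τ ν a b : ℝ} (ha : a ≠ 0)
    (h : (b : ℂ) = phase κ τ ν * a) :
    ∃ s : ℝ, (s = 1 ∨ s = -1) ∧ phase κ τ ν = s ∧ b = s * a := by
  have ha' : (a : ℂ) ≠ 0 := by exact_mod_cast ha
  have h1 : phase κ τ ν = ((b / a : ℝ) : ℂ) := by
    push_cast; rw [eq_div_iff ha', h]
  refine ⟨b / a, ?_, h1, by field_simp⟩
  have h2 := norm_phase hκ τ ν
  rw [h1, Complex.norm_real, Real.norm_eq_abs] at h2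
  exact eq_or_eq_neg_of_abs_eq h2

theorem abs_eq_abs_of_eq_phase_mul {κ : ℂ} (hκ : ‖κ‖ = 1) {τ ν a b : ℝ}
    (h : (b : ℂ) = phase κ τ ν * a) : |b| = |a| := by
  have := congrArg norm h
  rwa [norm_mul, norm_phase hκ, one_mul, Complex.norm_real, Complex.norm_real] at this

/-- The pair state of `a` and `b` as a real vector. -/
def realPair {W : Type*} [DecidableEq W] (a b : W) : W → ℝ :=
  Pi.single a 1 - Pi.single b 1

section RealPair

variable {W : Type*} [DecidableEq W]

theorem realPair_swap (a b : W) : realPair a b = -realPair b a := by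
  simp [realPair]

theorem ofReal_realPair (a b : W) : (fun i => ((realPair a b i : ℝ) : ℂ)) = pairState a b := by
  ext i
  simp only [realPair, pairState, Pi.sub_apply, Pi.single_apply]
  push_cast
  split_ifs <;> simp

theorem sym2_eq_of_realPair_eq {a b c d : W} (hab : a ≠ b) (hcd : c ≠ d) {σ : ℝ}
    (h : realPair c d = σ • realPair a b) : s(a, b) = s(c, d) := by
  have h1 := congrFun h c
  have h2 := congrFun h d
  simp only [realPair, Pi.sub_apply, Pi.smul_apply, Pi.single_apply, hcd, hcd.symm, if_true,
    if_false, smul_eq_mul] at h1 h2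
  rw [Sym2.eq_iff]
  by_cases h3 : c = a
  · subst h3
    by_cases h4 : d = b
    · left; exact ⟨rfl, h4.symm⟩
    · simp [h4, hcd.symm] at h2
  · by_cases h4 : c = b
    · subst h4
      by_cases h5 : d = a
      · right; exact ⟨h5.symm, rfl⟩
      · simp [h5, hcd.symm] at h2
    · simp [h3, h4] at h1

theorem dotProduct_realPair [Fintype W] (z : W → ℝ) (a b : W) :
    z ⬝ᵥ realPair a b = z a - z b := by
  simp [realPair, dotProduct_sub]

end RealPair

section Transfer

variable {V : Type*} [Fintype V] [DecidableEq V] (G : SimpleGraph V) [DecidableRel G.Adj]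

/-- State transfer from `x` to `y` in the Q-graph at time `τ`, expressed through the components of
the two states along real eigenvectors. The factor `κ` collects the phase `χ` of the transfer and
the one due to the shift of the Laplacian. -/
def Transfers (r : ℕ) (κ : ℂ) (τ : ℝ) (x y : V ⊕ G.edgeSet → ℝ) : Prop :=
  ∀ (ν : ℝ) (z : V ⊕ G.edgeSet → ℝ), qShift G ℝ r *ᵥ z = ν • z →
    ((z ⬝ᵥ y : ℝ) : ℂ) = phase κ τ ν * ((z ⬝ᵥ x : ℝ) : ℂ)

variable {G}

theorem Transfers.neg_left {r : ℕ} {κ : ℂ} {τ : ℝ} {x y : V ⊕ G.edgeSet → ℝ}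
    (h : Transfers G r κ τ x y) : Transfers G r (-κ) τ (-x) y := fun ν z hz => by
  rw [h ν z hz, phase, phase, dotProduct_neg]; push_cast; ring

theorem Transfers.neg_right {r : ℕ} {κ : ℂ} {τ : ℝ} {x y : V ⊕ G.edgeSet → ℝ}
    (h : Transfers G r κ τ x y) : Transfers G r (-κ) τ x (-y) := fun ν z hz => by
  rw [dotProduct_neg, Complex.ofReal_neg, h ν z hz, phase, phase]; ring

theorem Transfers.abs_eq {r : ℕ} {κ : ℂ} (hκ : ‖κ‖ = 1) {τ : ℝ} {x y : V ⊕ G.edgeSet → ℝ}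
    (h : Transfers G r κ τ x y) {ν : ℝ} {z : V ⊕ G.edgeSet → ℝ}
    (hz : qShift G ℝ r *ᵥ z = ν • z) : |z ⬝ᵥ y| = |z ⬝ᵥ x| :=
  abs_eq_abs_of_eq_phase_mul hκ (h ν z hz)

theorem ofReal_dotProduct {W : Type*} [Fintype W] (x y : W → ℝ) :
    ((x ⬝ᵥ y : ℝ) : ℂ) = (fun i => (x i : ℂ)) ⬝ᵥ (fun i => (y i : ℂ)) := by
  simp [dotProduct]

theorem exists_transfers_of_pairLPSTAt {r : ℕ} (hreg : G.IsRegularOfDegree r)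
    {a b c d : V ⊕ G.edgeSet} {τ : ℝ} (h : PairLPSTAt (qGraph G) a b c d τ) :
    ∃ κ : ℂ, ‖κ‖ = 1 ∧ Transfers G r κ τ (realPair a b) (realPair c d) := by
  obtain ⟨-, -, -, χ, hχ, h⟩ := h
  have hχ0 : χ ≠ 0 := by rintro rfl; simp at hχ
  refine ⟨χ⁻¹ * Complex.exp (-(Complex.I * τ) * (r + 1)), ?_, ?_⟩
  · have : -(Complex.I * τ) * (r + 1) = ((-(τ * (r + 1)) : ℝ) : ℂ) * Complex.I := by
      push_cast; ring
    rw [norm_mul, norm_inv, hχ, this, Complex.norm_exp_ofReal_mul_I]; simp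
  · intro ν z hz
    set zc : V ⊕ G.edgeSet → ℂ := fun i => (z i : ℂ) with hzc
    have h1 : qShift G ℂ r *ᵥ zc = (ν : ℂ) • zc := by
      ext i
      have := congrArg (fun x : ℝ => (x : ℂ)) (congrFun hz i)
      rw [← qShift_map G Complex.ofRealHom r]
      simpa [mulVec, dotProduct] using this
    have h2 : (-(Complex.I * τ) • (qGraph G).lapMatrix ℂ) *ᵥ zc =
        (-(Complex.I * τ) * (ν + (r + 1))) • zc := by
      rw [qGraph_lapMatrix G hreg, smul_mulVec, add_mulVec, h1, smul_mulVec, one_mulVec, ← add_smul,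
        smul_smul]
    have h3 := exp_mulVec_of_eigenvector h2
    have hsymm : (lapTransition (qGraph G) τ).IsSymm :=
      Matrix.IsSymm.exp ((SimpleGraph.isSymm_lapMatrix (R := ℂ) _).smul _)
    have h4 : zc ⬝ᵥ (lapTransition (qGraph G) τ *ᵥ pairState a b) =
        Complex.exp (-(Complex.I * τ) * (ν + (r + 1))) * (zc ⬝ᵥ pairState a b) := by
      rw [dotProduct_mulVec, ← mulVec_transpose, hsymm.eq, lapTransition, h3, smul_dotProduct,
        smul_eq_mul]
    rw [h, dotProduct_smul, smul_eq_mul, mul_add, Complex.exp_add] at h4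
    rw [ofReal_dotProduct, ofReal_dotProduct, ofReal_realPair, ofReal_realPair, phase]
    apply mul_left_cancel₀ hχ0
    rw [h4]
    field_simp
    rfl

end Transfer

section Cases

variable {V : Type*} [Fintype V] [DecidableEq V] {G : SimpleGraph V} [DecidableRel G.Adj]

/-! ### A common sign for all components -/

theorem exists_roots (a : ℝ) {N : ℝ} (hN : 0 < N) :
    ∃ x y : ℝ, x * y = -N ∧ x + y = -a ∧ x ^ 2 + a * x = N ∧ y ^ 2 + a * y = N := by
  have hs : √(a ^ 2 + 4 * N) ^ 2 = a ^ 2 + 4 * N := Real.sq_sqrt (by positivity)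
  refine ⟨(-a + √(a ^ 2 + 4 * N)) / 2, (-a - √(a ^ 2 + 4 * N)) / 2, ?_, ?_, ?_, ?_⟩ <;>
    linarith

theorem dotProduct_edgeInc_mulVec (p : V → ℝ) (w : G.edgeSet → ℝ) :
    ((edgeInc G ℝ)ᵀ *ᵥ p) ⬝ᵥ w = p ⬝ᵥ (edgeInc G ℝ *ᵥ w) := by
  rw [dotProduct_mulVec, mulVec_transpose]

/-- If for every adjacency eigenvalue other than `-r` the components of `u` and `v` differ by the
phases of both associated Laplacian eigenvalues, then they differ by one common sign. -/
theorem exists_common_sign {r t : ℕ} (hr : r + 1 = 2 ^ t) {κ : ℂ} (hκ : ‖κ‖ = 1) {τ : ℝ}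
    {u v : V → ℝ} (H : ∀ (a : ℝ) (p : V → ℝ), G.adjMatrix ℝ *ᵥ p = a • p → a ≠ -r →
      ∀ ν : ℝ, ν ^ 2 + a * ν = r + 1 →
        ((p ⬝ᵥ v : ℝ) : ℂ) = phase κ τ ν * ((p ⬝ᵥ u : ℝ) : ℂ)) :
    ∃ σ : ℝ, (σ = 1 ∨ σ = -1) ∧ ∀ (a : ℝ) (p : V → ℝ), G.adjMatrix ℝ *ᵥ p = a • p → a ≠ -r →
      p ⬝ᵥ v = σ * (p ⬝ᵥ u) := by
  have hr' : (r + 1 : ℝ) = 2 ^ t := by exact_mod_cast hr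
  have hN : (0 : ℝ) < r + 1 := by positivity
  by_cases hex : ∃ (a : ℝ) (p : V → ℝ), G.adjMatrix ℝ *ᵥ p = a • p ∧ a ≠ -r ∧ p ⬝ᵥ u ≠ 0
  · obtain ⟨a, p, hp, ha, hpu⟩ := hex
    obtain ⟨x₁, x₂, hx, -, hx₁, hx₂⟩ := exists_roots a hN
    obtain ⟨σ, hσ, hph, hpv⟩ := exists_sign_of_eq_phase_mul hκ hpu (H a p hp ha x₁ hx₁)
    refine ⟨σ, hσ, fun b q hq hb => ?_⟩
    obtain ⟨y₁, y₂, hy, -, hy₁, hy₂⟩ := exists_roots b hN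
    by_cases hqu : q ⬝ᵥ u = 0
    · have := H b q hq hb y₁ hy₁
      rw [hqu, Complex.ofReal_zero, mul_zero, Complex.ofReal_eq_zero] at this
      rw [hqu, this, mul_zero]
    obtain ⟨σ', hσ', hph', hqv⟩ := exists_sign_of_eq_phase_mul hκ hqu (H b q hq hb y₁ hy₁)
    have hpu' : ((p ⬝ᵥ u : ℝ) : ℂ) ≠ 0 := by exact_mod_cast hpu
    have hqu' : ((q ⬝ᵥ u : ℝ) : ℂ) ≠ 0 := by exact_mod_cast hqu
    by_cases hs : σ' = σ
    · rw [hqv, hs]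
    exfalso
    have hneg : σ = -σ' := by
      rcases hσ with rfl | rfl <;> rcases hσ' with rfl | rfl <;> simp_all
    obtain ⟨m, hm⟩ := (phase_eq_phase_iff hκ).1
      (mul_right_cancel₀ hpu' ((H a p hp ha x₁ hx₁).symm.trans (H a p hp ha x₂ hx₂)))
    obtain ⟨n, hn⟩ := (phase_eq_phase_iff hκ).1
      (mul_right_cancel₀ hqu' ((H b q hq hb y₁ hy₁).symm.trans (H b q hq hb y₂ hy₂)))
    obtain ⟨l, hl⟩ := exists_odd_of_phase_eq_neg hκ
      (hph.trans (by rw [hneg, hph']; push_cast; rfl) : phase κ τ x₁ = -phase κ τ y₁)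
    have hint : IsIntegral ℤ a :=
      isIntegral_of_adjMatrix_eigenvector G (fun h => hpu (by rw [h, zero_dotProduct])) hp
    rw [hr'] at hx hy
    exact not_opposite_phase
      (isIntegral_of_sq_add_mul_eq (N := r + 1) hint (by rw [hx₁]; push_cast; rfl))
      (isIntegral_of_sq_add_mul_eq (N := r + 1) hint (by rw [hx₂]; push_cast; rfl)) hx hy hm hn hl
  · push Not at hex
    refine ⟨1, Or.inl rfl, fun a p hp ha => ?_⟩
    obtain ⟨x₁, x₂, -, -, hx₁, -⟩ := exists_roots a hN
    have := H a p hp ha x₁ hx₁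
    rw [hex a p hp ha, Complex.ofReal_zero, mul_zero, Complex.ofReal_eq_zero] at this
    rw [hex a p hp ha, this, mul_zero]

theorem edgeInc_transpose_mulVec_sub_smul_eq_zero {r : ℕ} (hreg : G.IsRegularOfDegree r) {σ : ℝ}
    {u v : V → ℝ} (H : ∀ (a : ℝ) (p : V → ℝ), G.adjMatrix ℝ *ᵥ p = a • p → a ≠ -r →
      p ⬝ᵥ v = σ * (p ⬝ᵥ u)) : (edgeInc G ℝ)ᵀ *ᵥ (v - σ • u) = 0 := by
  refine edgeInc_transpose_mulVec_eq_zero G hreg ?_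
  have : G.adjMatrix ℝ *ᵥ (v - σ • u) + (r : ℝ) • (v - σ • u) = 0 := by
    refine eq_zero_of_forall_eigenvector (G.isSymm_adjMatrix (α := ℝ)) fun a p hp => ?_
    rw [dotProduct_add, dotProduct_mulVec_of_eigenvector (G.isSymm_adjMatrix (α := ℝ)) hp,
      dotProduct_smul, smul_eq_mul, ← add_mul]
    by_cases ha : a = -r
    · rw [ha]; ring
    · rw [dotProduct_sub, dotProduct_smul, H a p hp ha]; simp
  rw [neg_smul]; exact eq_neg_of_add_eq_zero_left this

/-! ### Pairs of original vertices -/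

theorem not_transfers_vertex_vertex {r t : ℕ} (hreg : G.IsRegularOfDegree r) (hr3 : 3 ≤ r)
    (hr : r + 1 = 2 ^ t) {κ : ℂ} (hκ : ‖κ‖ = 1) {τ : ℝ} {a b c d : V} (hab : a ≠ b) (hcd : c ≠ d)
    (hne : s(a, b) ≠ s(c, d))
    (hT : Transfers G r κ τ (Sum.elim (realPair a b) 0) (Sum.elim (realPair c d) 0)) : False := by
  obtain ⟨σ, hσ, H⟩ := exists_common_sign (G := G) hr hκ (τ := τ) (u := realPair a b)
    (v := realPair c d) fun e p hp he ν hν => by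
      have h1 := hT ν _ (qShift_mulVec_lift G hreg hp hν)
      rw [sumElim_dotProduct_sumElim, sumElim_dotProduct_sumElim, dotProduct_zero,
        add_zero, add_zero, smul_dotProduct, smul_dotProduct, smul_eq_mul, smul_eq_mul,
        Complex.ofReal_mul, Complex.ofReal_mul] at h1
      have h2 : ((r + e : ℝ) : ℂ) ≠ 0 := by
        rw [Complex.ofReal_ne_zero]; intro h; exact he (by linarith)
      apply mul_left_cancel₀ h2
      rw [h1]; ring
  set h : V → ℝ := realPair c d - σ • realPair a b with hh
  have hR : (edgeInc G ℝ)ᵀ *ᵥ h = 0 := edgeInc_transpose_mulVec_sub_smul_eq_zero hreg H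
  have hadj : ∀ v w, G.Adj v w → h w = -h v := fun v w hvw => by
    have := edgeInc_transpose_mulVec_apply G h hvw
    rw [hR, Pi.zero_apply] at this; linarith
  have h0 : h ≠ 0 := fun h0 => hne (sym2_eq_of_realPair_eq hab hcd (sub_eq_zero.1 h0))
  obtain ⟨v, hv⟩ := Function.ne_iff.1 h0
  rw [Pi.zero_apply] at hv
  -- `h` vanishes outside `{a, b, c, d}`, but not on the neighbours of two adjacent vertices
  have hsupp : ∀ w, h w ≠ 0 → w ∈ ({a, b, c, d} : Finset V) := fun w hw => by
    by_contra hcon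
    simp only [Finset.mem_insert, Finset.mem_singleton, not_or] at hcon
    exact hw (by simp [hh, realPair, hcon])
  have hdeg : ∀ w, (G.neighborFinset w).card = r := fun w => hreg.degree_eq w
  obtain ⟨w, hw⟩ : (G.neighborFinset v).Nonempty := by
    rw [← Finset.card_pos, hdeg]; omega
  rw [SimpleGraph.mem_neighborFinset] at hw
  have hdisj : Disjoint (G.neighborFinset v) (G.neighborFinset w) := by
    rw [Finset.disjoint_left]
    intro x hx hx'
    rw [SimpleGraph.mem_neighborFinset] at hx hx'
    have h1 := hadj v x hx
    have h2 := hadj w x hx'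
    have h3 := hadj v w hw
    exact hv (by linarith)
  have hsub : G.neighborFinset v ∪ G.neighborFinset w ⊆ {a, b, c, d} := by
    intro x hx
    rw [Finset.mem_union, SimpleGraph.mem_neighborFinset, SimpleGraph.mem_neighborFinset] at hx
    refine hsupp x ?_
    rcases hx with hx | hx
    · rw [hadj v x hx]; exact neg_ne_zero.2 hv
    · rw [hadj w x hx, hadj v w hw, neg_neg]; exact hv
  have hcard := Finset.card_le_card hsub
  rw [Finset.card_union_of_disjoint hdisj, hdeg, hdeg] at hcard
  have := hcard.trans Finset.card_le_four
  omega

/-! ### A pair of original vertices and a pair of new vertices -/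

/-- A pair state of two original vertices and a vector on the new vertices do not have components
of the same size along all eigenvectors: otherwise the two eigenvalues belonging to each adjacency
eigenvalue `e` in the support would satisfy `|x + 1| = |y + 1|`, hence `e = 2`, and `e_a - e_b`
would be an eigenvector of the adjacency matrix with eigenvalue `2`. -/
theorem not_abs_eq_vertex_edge {r : ℕ} (hreg : G.IsRegularOfDegree r) {a b : V} (hab : a ≠ b)
    {w : G.edgeSet → ℝ} (hT : ∀ (ν : ℝ) (z : V ⊕ G.edgeSet → ℝ), qShift G ℝ r *ᵥ z = ν • z →
      |z ⬝ᵥ Sum.elim (realPair a b) 0| = |z ⬝ᵥ Sum.elim 0 w|) : False := by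
  have hN : (0 : ℝ) < r + 1 := by positivity
  set u := realPair a b with hu
  have key : ∀ (e : ℝ) (p : V → ℝ), G.adjMatrix ℝ *ᵥ p = e • p → p ⬝ᵥ u ≠ 0 → e = 2 := by
    intro e p hp hpu
    have he : e ≠ -r := by
      rintro rfl
      have := hT _ _ (qShift_mulVec_of_transpose_ker G (r := r)
        (edgeInc_transpose_mulVec_eq_zero G hreg hp))
      simp [sumElim_dotProduct_sumElim, hpu] at this
    have he' : r + e ≠ 0 := fun h => he (by linarith)
    obtain ⟨x, y, hxy, hsum, hx, hy⟩ := exists_roots e hN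
    have hmain : ∀ ν : ℝ, ν ^ 2 + e * ν = r + 1 →
        |(r + e) * (p ⬝ᵥ u)| = |ν + 1| * |p ⬝ᵥ (edgeInc G ℝ *ᵥ w)| := fun ν hν => by
      have := hT _ _ (qShift_mulVec_lift G hreg hp hν)
      rw [sumElim_dotProduct_sumElim, sumElim_dotProduct_sumElim, dotProduct_zero, dotProduct_zero,
        add_zero, zero_add, smul_dotProduct, smul_dotProduct, dotProduct_edgeInc_mulVec] at this
      rw [← abs_neg (ν + 1), ← abs_mul]
      exact this
    have h1 := hmain x hx
    have h2 := hmain y hy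
    have hc : |p ⬝ᵥ (edgeInc G ℝ *ᵥ w)| ≠ 0 := by
      intro h
      rw [h, mul_zero, abs_eq_zero] at h1
      exact mul_ne_zero he' hpu h1
    have h3 := mul_right_cancel₀ hc (h1.symm.trans h2)
    rcases abs_eq_abs.1 h3 with h4 | h4
    · have : x = y := by linarith
      subst this
      nlinarith [mul_self_nonneg x]
    · linarith
  have hA : G.adjMatrix ℝ *ᵥ u - (2 : ℝ) • u = 0 := by
    refine eq_zero_of_forall_eigenvector (G.isSymm_adjMatrix (α := ℝ)) fun e p hp => ?_
    rw [dotProduct_sub, dotProduct_mulVec_of_eigenvector (G.isSymm_adjMatrix (α := ℝ)) hp,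
      dotProduct_smul, smul_eq_mul, ← sub_mul]
    by_cases hpu : p ⬝ᵥ u = 0
    · rw [hpu, mul_zero]
    · rw [key e p hp hpu]; ring
  have h1 := congrFun hA a
  have h2 : (G.adjMatrix ℝ *ᵥ u) a = G.adjMatrix ℝ a a - G.adjMatrix ℝ a b :=
    dotProduct_realPair _ a b
  rw [Pi.sub_apply, h2, Pi.smul_apply, hu, realPair, Pi.sub_apply, Pi.single_eq_same,
    Pi.single_eq_of_ne hab, SimpleGraph.adjMatrix_apply, SimpleGraph.adjMatrix_apply] at h1
  by_cases h : G.Adj a b <;> simp [h] at h1; norm_num at h1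

/-! ### Pairs of new vertices -/

theorem edgeInc_mulVec_realPair (f h : G.edgeSet) (v : V) :
    (edgeInc G ℝ *ᵥ realPair f h) v = edgeInc G ℝ v f - edgeInc G ℝ v h :=
  dotProduct_realPair _ f h

theorem neg_le_of_adjMatrix_eigenvector {r : ℕ} (hreg : G.IsRegularOfDegree r) {a : ℝ} {p : V → ℝ}
    (h0 : p ≠ 0) (hp : G.adjMatrix ℝ *ᵥ p = a • p) : -(r : ℝ) ≤ a := by
  have h1 : ((edgeInc G ℝ)ᵀ *ᵥ p) ⬝ᵥ ((edgeInc G ℝ)ᵀ *ᵥ p) = (a + r) * (p ⬝ᵥ p) := by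
    rw [dotProduct_edgeInc_mulVec, edgeInc_mulVec_transpose_mulVec G hreg, hp, ← add_smul,
      dotProduct_smul, smul_eq_mul]
  have h2 : 0 ≤ ((edgeInc G ℝ)ᵀ *ᵥ p) ⬝ᵥ ((edgeInc G ℝ)ᵀ *ᵥ p) :=
    Finset.sum_nonneg fun i _ => mul_self_nonneg _
  have h3 : 0 < p ⬝ᵥ p := lt_of_le_of_ne (Finset.sum_nonneg fun i _ => mul_self_nonneg _)
    (fun h => h0 (dotProduct_self_eq_zero.1 h.symm))
  rw [h1] at h2
  have := nonneg_of_mul_nonneg_left h2 h3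
  linarith

/-- A time at which every component of the rational vector `u` is in opposite phase to the
eigenvalue `r + 1` is a rational multiple of `π`. If two adjacency eigenvalues occur in `u`, a
linear equation over `ℚ` for the time results from the products of the two pairs of eigenvalues; if
only one occurs, that one is rational. -/
theorem exists_rat_time {r : ℕ} (hreg : G.IsRegularOfDegree r) {ρ : ℝ} {u : V → ℚ}
    (H : ∀ (a : ℝ) (p : V → ℝ), G.adjMatrix ℝ *ᵥ p = a • p → p ⬝ᵥ (fun i => (u i : ℝ)) ≠ 0 →
      ∀ ν : ℝ, ν ^ 2 + a * ν = r + 1 → ∃ l : ℤ, ρ * ((r + 1) - ν) = 2 * l + 1)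
    {a : ℝ} {p : V → ℝ} (hp : G.adjMatrix ℝ *ᵥ p = a • p)
    (hpu : p ⬝ᵥ (fun i => (u i : ℝ)) ≠ 0) : ∃ q : ℚ, ρ = q := by
  have hN : (0 : ℝ) < r + 1 := by positivity
  obtain ⟨x₁, x₂, hx, hsx, hx₁, hx₂⟩ := exists_roots a hN
  obtain ⟨l₁, hl₁⟩ := H a p hp hpu x₁ hx₁
  obtain ⟨l₂, hl₂⟩ := H a p hp hpu x₂ hx₂
  have hρ : ρ ≠ 0 := by
    rintro rfl
    rw [zero_mul] at hl₁
    have : (0 : ℤ) = 2 * l₁ + 1 := by exact_mod_cast hl₁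
    omega
  by_cases hex : ∃ (b : ℝ) (q : V → ℝ), G.adjMatrix ℝ *ᵥ q = b • q ∧
      q ⬝ᵥ (fun i => (u i : ℝ)) ≠ 0 ∧ b ≠ a
  · obtain ⟨b, q, hq, hqu, hba⟩ := hex
    obtain ⟨y₁, y₂, hy, hsy, hy₁, hy₂⟩ := exists_roots b hN
    obtain ⟨k₁, hk₁⟩ := H b q hq hqu y₁ hy₁
    obtain ⟨k₂, hk₂⟩ := H b q hq hqu y₂ hy₂
    have hD : (2 * k₁ + 1 + (2 * k₂ + 1) - (2 * l₁ + 1) - (2 * l₂ + 1) : ℝ) ≠ 0 := by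
      rw [← hk₁, ← hk₂, ← hl₁, ← hl₂]
      intro h
      have : ρ * (b - a) = 0 := by linear_combination h + ρ * hsy - ρ * hsx
      exact (mul_ne_zero hρ (sub_ne_zero.2 hba)) this
    refine ⟨((2 * k₁ + 1) * (2 * k₂ + 1) - (2 * l₁ + 1) * (2 * l₂ + 1)) /
      ((2 * k₁ + 1 + (2 * k₂ + 1) - (2 * l₁ + 1) - (2 * l₂ + 1)) * (r + 1)), ?_⟩
    push_cast
    rw [eq_div_iff (mul_ne_zero hD hN.ne')]
    have e1 : (ρ * (r + 1) - (2 * l₁ + 1)) * (ρ * (r + 1) - (2 * l₂ + 1)) = -ρ ^ 2 * (r + 1) := by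
      rw [← hl₁, ← hl₂]; linear_combination ρ ^ 2 * hx
    have e2 : (ρ * (r + 1) - (2 * k₁ + 1)) * (ρ * (r + 1) - (2 * k₂ + 1)) = -ρ ^ 2 * (r + 1) := by
      rw [← hk₁, ← hk₂]; linear_combination ρ ^ 2 * hy
    linear_combination e1 - e2
  · push Not at hex
    have hA : G.adjMatrix ℝ *ᵥ (fun i => (u i : ℝ)) - a • (fun i => (u i : ℝ)) = 0 := by
      refine eq_zero_of_forall_eigenvector (G.isSymm_adjMatrix (α := ℝ)) fun b q hq => ?_
      rw [dotProduct_sub, dotProduct_mulVec_of_eigenvector (G.isSymm_adjMatrix (α := ℝ)) hq,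
        dotProduct_smul, smul_eq_mul, ← sub_mul]
      by_cases hqu : q ⬝ᵥ (fun i => (u i : ℝ)) = 0
      · rw [hqu, mul_zero]
      · rw [hex b q hq hqu, sub_self, zero_mul]
    obtain ⟨i, hi⟩ : ∃ i, u i ≠ 0 := by
      by_contra hcon
      push Not at hcon
      exact hpu (by simp [dotProduct, hcon])
    have hi' : (u i : ℝ) ≠ 0 := by exact_mod_cast hi
    have ha : a = (((G.adjMatrix ℚ *ᵥ u) i / u i : ℚ) : ℝ) := by
      have h1 := congrFun hA i
      have h2 : (((G.adjMatrix ℚ *ᵥ u) i : ℚ) : ℝ) =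
          (G.adjMatrix ℝ *ᵥ (fun i => (u i : ℝ))) i := by
        simp only [mulVec, dotProduct, SimpleGraph.adjMatrix_apply]
        push_cast
        simp only [apply_ite (Rat.cast : ℚ → ℝ), Rat.cast_one, Rat.cast_zero]
      rw [Rat.cast_div, eq_div_iff hi', h2]
      simp only [Pi.sub_apply, Pi.smul_apply, smul_eq_mul, Pi.zero_apply] at h1
      linarith
    have hge := neg_le_of_adjMatrix_eigenvector hreg
      (fun h => hpu (by rw [h, zero_dotProduct])) hp
    have hpos : 2 * (r + 1 : ℝ) + a ≠ 0 := by
      have : (0 : ℝ) ≤ r := by positivity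
      intro h; linarith
    refine ⟨(2 * l₁ + 1 + (2 * l₂ + 1)) / (2 * (r + 1) + (G.adjMatrix ℚ *ᵥ u) i / u i), ?_⟩
    rw [Rat.cast_div, Rat.cast_add (2 * ((r : ℚ) + 1)), ← ha]
    push_cast
    rw [eq_div_iff hpos, ← hl₁, ← hl₂]
    linear_combination ρ * hsx

/-- Let `u` be the image of `w` under the incidence matrix `R`. If `w` and `w'` have opposite
components on the kernel of `R` and `R w' = σ u = R (σ w)`, while `u` is a null vector of the
adjacency matrix, then `r (w' + σ w) = 2 σ Rᵀ u`. -/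
theorem add_smul_eq_of_adjMatrix_mulVec_eq_zero {r : ℕ} (hreg : G.IsRegularOfDegree r)
    {σ : ℝ} {w w' : G.edgeSet → ℝ}
    (hσw : edgeInc G ℝ *ᵥ w' = σ • (edgeInc G ℝ *ᵥ w))
    (hker : ∀ g, edgeInc G ℝ *ᵥ g = 0 → g ⬝ᵥ w' = -σ * (g ⬝ᵥ w))
    (hA : G.adjMatrix ℝ *ᵥ (edgeInc G ℝ *ᵥ w) = 0) :
    (r : ℝ) • (w' + σ • w) = (2 * σ) • ((edgeInc G ℝ)ᵀ *ᵥ (edgeInc G ℝ *ᵥ w)) := by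
  obtain ⟨h, hh⟩ : ∃ h, h =
    (r : ℝ) • (w' + σ • w) - (2 * σ) • ((edgeInc G ℝ)ᵀ *ᵥ (edgeInc G ℝ *ᵥ w)) := ⟨_, rfl⟩
  have hR : edgeInc G ℝ *ᵥ h = 0 := by
    rw [hh, mulVec_sub, mulVec_smul, mulVec_add, mulVec_smul, mulVec_smul,
      edgeInc_mulVec_transpose_mulVec G hreg, hA, hσw]
    ext v; simp; ring
  have h0 : h ⬝ᵥ h = 0 := by
    have h1 : h ⬝ᵥ ((edgeInc G ℝ)ᵀ *ᵥ (edgeInc G ℝ *ᵥ w)) = 0 := by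
      rw [dotProduct_comm, dotProduct_edgeInc_mulVec, hR, dotProduct_zero]
    have h2 : h ⬝ᵥ (w' + σ • w) = 0 := by
      rw [dotProduct_add, dotProduct_smul, hker h hR, smul_eq_mul]; ring
    conv_lhs => rhs; rw [hh]
    rw [dotProduct_sub, dotProduct_smul, dotProduct_smul, h1, h2, smul_zero, smul_zero, sub_zero]
  rw [dotProduct_self_eq_zero.1 h0] at hh
  exact sub_eq_zero.1 hh.symm

theorem not_transfers_edge_edge {r t : ℕ} (hreg : G.IsRegularOfDegree r) (hr3 : 3 ≤ r)
    (hr : r + 1 = 2 ^ t) (ht : t ≠ 0) {κ : ℂ} (hκ : ‖κ‖ = 1) {τ : ℝ} {f h g l : G.edgeSet}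
    (hfh : f ≠ h) (hgl : g ≠ l) (hne : s(f, h) ≠ s(g, l))
    (hT : Transfers G r κ τ (Sum.elim 0 (realPair f h)) (Sum.elim 0 (realPair g l))) : False := by
  have hr' : (r + 1 : ℝ) = 2 ^ t := by exact_mod_cast hr
  set w := realPair f h with hw
  set w' := realPair g l with hw'
  have H0 : ∀ (a : ℝ) (p : V → ℝ), G.adjMatrix ℝ *ᵥ p = a • p → a ≠ -r →
      ∀ ν : ℝ, ν ^ 2 + a * ν = r + 1 → ((p ⬝ᵥ (edgeInc G ℝ *ᵥ w') : ℝ) : ℂ) =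
        phase κ τ ν * ((p ⬝ᵥ (edgeInc G ℝ *ᵥ w) : ℝ) : ℂ) := fun a p hp ha ν hν => by
    have h1 := hT ν _ (qShift_mulVec_lift G hreg hp hν)
    rw [sumElim_dotProduct_sumElim, sumElim_dotProduct_sumElim, dotProduct_zero,
      zero_add, zero_add, smul_dotProduct, smul_dotProduct, smul_eq_mul, smul_eq_mul,
      dotProduct_edgeInc_mulVec, dotProduct_edgeInc_mulVec, Complex.ofReal_mul,
      Complex.ofReal_mul] at h1
    have h2 : ((-(ν + 1) : ℝ) : ℂ) ≠ 0 := by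
      rw [Complex.ofReal_ne_zero]
      intro h
      have h3 : ν = -1 := by linarith
      rw [h3] at hν
      exact ha (by linarith)
    apply mul_left_cancel₀ h2
    rw [h1]; ring
  obtain ⟨σ, hσ, H⟩ := exists_common_sign (G := G) hr hκ H0
  have hσ2 : σ * σ = 1 := by rcases hσ with rfl | rfl <;> norm_num
  have hσ0 : σ ≠ 0 := fun h => by simp [h] at hσ2
  set d : G.edgeSet → ℝ := w' - σ • w with hd
  have hRd : edgeInc G ℝ *ᵥ d = 0 := by
    have h1 : (edgeInc G ℝ)ᵀ *ᵥ (edgeInc G ℝ *ᵥ d) = 0 := by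
      rw [hd, mulVec_sub, mulVec_smul]
      exact edgeInc_transpose_mulVec_sub_smul_eq_zero hreg H
    rw [← dotProduct_self_eq_zero, ← dotProduct_edgeInc_mulVec, h1, zero_dotProduct]
  have hσw : edgeInc G ℝ *ᵥ w' = σ • (edgeInc G ℝ *ᵥ w) := by
    rw [hd, mulVec_sub, mulVec_smul] at hRd
    exact sub_eq_zero.1 hRd
  have hd0 : d ≠ 0 := fun h0 => hne (sym2_eq_of_realPair_eq hfh hgl (sub_eq_zero.1 h0))
  have hdd : d ⬝ᵥ w' - σ * (d ⬝ᵥ w) ≠ 0 := fun h => hd0 (dotProduct_self_eq_zero.1 (by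
    rw [← h]; conv_lhs => rw [hd]
    rw [← hd, dotProduct_comm, hd, ← hd, dotProduct_sub, dotProduct_smul, smul_eq_mul]))
  have hkerT : ∀ k, edgeInc G ℝ *ᵥ k = 0 →
      ((k ⬝ᵥ w' : ℝ) : ℂ) = phase κ τ (r + 1) * ((k ⬝ᵥ w : ℝ) : ℂ) := fun k hk => by
    have := hT _ _ (qShift_mulVec_of_ker G (r := r) hk)
    simpa only [sumElim_dotProduct_sumElim, dotProduct_zero, zero_add] using this
  -- the eigenvalue `r + 1` is in the support, in opposite phase to all other eigenvalues
  have hdw : d ⬝ᵥ w ≠ 0 := fun h => by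
    have h1 := hkerT d hRd
    rw [h, Complex.ofReal_zero, mul_zero, Complex.ofReal_eq_zero] at h1
    exact hdd (by rw [h, h1]; ring)
  obtain ⟨s, hs, hphN, hds⟩ := exists_sign_of_eq_phase_mul hκ hdw (hkerT d hRd)
  have hsσ : s = -σ := by
    have : s ≠ σ := fun h => hdd (by rw [hds, h]; ring)
    rcases hσ with rfl | rfl <;> rcases hs with rfl | rfl <;> simp_all
  subst hsσ
  have hker : ∀ k, edgeInc G ℝ *ᵥ k = 0 → k ⬝ᵥ w' = -σ * (k ⬝ᵥ w) := fun k hk => by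
    have := hkerT k hk
    rw [hphN] at this
    exact_mod_cast this
  have hnotr : ∀ (a : ℝ) (p : V → ℝ), G.adjMatrix ℝ *ᵥ p = a • p →
      p ⬝ᵥ (edgeInc G ℝ *ᵥ w) ≠ 0 → a ≠ -r := by
    rintro a p hp hpu rfl
    rw [← dotProduct_edgeInc_mulVec, edgeInc_transpose_mulVec_eq_zero G hreg hp,
      zero_dotProduct] at hpu
    exact hpu rfl
  have hodd : ∀ (a : ℝ) (p : V → ℝ), G.adjMatrix ℝ *ᵥ p = a • p →
      p ⬝ᵥ (edgeInc G ℝ *ᵥ w) ≠ 0 → ∀ ν : ℝ, ν ^ 2 + a * ν = r + 1 →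
        ∃ l : ℤ, τ / Real.pi * ((r + 1) - ν) = 2 * l + 1 := by
    intro a p hp hpu ν hν
    have ha := hnotr a p hp hpu
    have h1 := H0 a p hp ha ν hν
    rw [H a p hp ha, Complex.ofReal_mul] at h1
    have h2 : (σ : ℂ) = phase κ τ ν := mul_right_cancel₀ (by exact_mod_cast hpu) h1
    refine exists_odd_of_phase_eq_neg hκ ?_
    rw [hphN, ← h2]; push_cast; rfl
  have hrat : edgeInc G ℝ *ᵥ w =
      fun i => (((edgeInc G ℚ i f - edgeInc G ℚ i h : ℚ)) : ℝ) := by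
    ext i
    rw [hw, edgeInc_mulVec_realPair, edgeInc_apply, edgeInc_apply, edgeInc_apply, edgeInc_apply]
    push_cast
    simp only [apply_ite (Rat.cast : ℚ → ℝ), Rat.cast_one, Rat.cast_zero]
  have hA : G.adjMatrix ℝ *ᵥ (edgeInc G ℝ *ᵥ w) = 0 := by
    refine eq_zero_of_forall_eigenvector (G.isSymm_adjMatrix (α := ℝ)) fun a p hp => ?_
    rw [dotProduct_mulVec_of_eigenvector (G.isSymm_adjMatrix (α := ℝ)) hp]
    by_cases hpu : p ⬝ᵥ (edgeInc G ℝ *ᵥ w) = 0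
    · rw [hpu, mul_zero]
    obtain ⟨q, hq⟩ := exists_rat_time hreg (fun b k hb hk => hodd b k hb (by rwa [hrat])) hp
      (by rwa [hrat] at hpu)
    obtain ⟨x, y, hxy, hsum, hx, hy⟩ := exists_roots a (N := (r + 1 : ℝ)) (by positivity)
    obtain ⟨l₁, hl₁⟩ := hodd a p hp hpu x hx
    obtain ⟨l₂, hl₂⟩ := hodd a p hp hpu y hy
    have hint : IsIntegral ℤ a :=
      isIntegral_of_adjMatrix_eigenvector G (fun h => hpu (by rw [h, zero_dotProduct])) hp
    rw [hq, hr'] at hl₁ hl₂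
    rw [hr'] at hxy
    have h0 := add_eq_zero_of_opposite_phase ht
      (isIntegral_of_sq_add_mul_eq (N := r + 1) hint (by rw [hx]; push_cast; rfl))
      (isIntegral_of_sq_add_mul_eq (N := r + 1) hint (by rw [hy]; push_cast; rfl)) hxy hl₁ hl₂
    have : a = 0 := by linarith
    rw [this, zero_mul]
  -- at the edge `f` the resulting identity says that `r` divides `2` or `4`
  have hfin := congrFun (add_smul_eq_of_adjMatrix_mulVec_eq_zero hreg hσw hker hA) f
  have h1 : ((edgeInc G ℝ)ᵀ *ᵥ (edgeInc G ℝ *ᵥ w)) f =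
      ((edgeInc G ℝ)ᵀ * edgeInc G ℝ) f f - ((edgeInc G ℝ)ᵀ * edgeInc G ℝ) f h := by
    rw [mulVec_mulVec]; exact dotProduct_realPair _ f h
  have hwf : w f = 1 := by simp [hw, realPair, hfh]
  obtain ⟨n, hn, hn'⟩ : ∃ n : ℤ, w' f = n ∧ (n = 0 ∨ n = 1 ∨ n = -1) := by
    by_cases h2 : f = g
    · exact ⟨1, by subst h2; simp [hw', realPair, hgl], by simp⟩
    · by_cases h3 : f = l
      · exact ⟨-1, by subst h3; simp [hw', realPair, hgl.symm], by simp⟩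
      · exact ⟨0, by simp [hw', realPair, h2, h3], by simp⟩
  obtain ⟨c, hc, hc'⟩ : ∃ c : ℤ, ((edgeInc G ℝ)ᵀ * edgeInc G ℝ) f f -
      ((edgeInc G ℝ)ᵀ * edgeInc G ℝ) f h = c ∧ (c = 1 ∨ c = 2) := by
    rw [edgeInc_transpose_mul_apply, edgeInc_transpose_mul_apply, if_pos rfl, if_neg hfh]
    split_ifs
    · exact ⟨1, by norm_num, by simp⟩
    · exact ⟨2, by norm_num, by simp⟩
  rw [Pi.smul_apply, Pi.smul_apply, Pi.add_apply, Pi.smul_apply, h1, hc, hn, hwf] at hfin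
  have heven : ¬ 2 ∣ r := fun h2 => by
    obtain ⟨t, rfl⟩ := Nat.exists_eq_add_one_of_ne_zero ht
    rw [pow_succ] at hr; omega
  simp only [smul_eq_mul, mul_one] at hfin
  have hfinZ : (r : ℤ) * (n + 1) = 2 * c ∨ (r : ℤ) * (n - 1) = -2 * c := by
    rcases hσ with rfl | rfl
    · left; have : (r : ℝ) * (n + 1) = 2 * c := by linarith
      exact_mod_cast this
    · right; have : (r : ℝ) * (n - 1) = -2 * c := by linarith
      exact_mod_cast this
  rcases hn' with rfl | rfl | rfl <;> rcases hc' with rfl | rfl <;> omega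

/-! ### Pairs of an original and a new vertex -/

/-- In an `r`-regular graph with `r ≥ 3` every edge is contained in the support of a null vector of
the incidence matrix. Otherwise there is a `p` with `p v + p w = 0` along all edges `vw` but one,
`cd`, where the sum is `1`; the signs of `p` on the vertices where `|p| = |p c|` give an integral
vector `s` with `r ∑ s = s c + s d`, a number in `{1, 2}`. -/
theorem exists_ker_edgeInc_apply_ne_zero {r : ℕ} (hreg : G.IsRegularOfDegree r) (hr3 : 3 ≤ r)
    (f : G.edgeSet) : ∃ g : G.edgeSet → ℝ, edgeInc G ℝ *ᵥ g = 0 ∧ g f ≠ 0 := by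
  by_contra hcon
  push Not at hcon
  have hmem : (LinearMap.proj f : (G.edgeSet → ℝ) →ₗ[ℝ] ℝ) ∈
      (LinearMap.ker (edgeInc G ℝ).mulVecLin).dualAnnihilator := by
    rw [Submodule.mem_dualAnnihilator]
    intro g hg
    exact hcon g (by simpa using hg)
  rw [← LinearMap.range_dualMap_eq_dualAnnihilator_ker] at hmem
  obtain ⟨φ, hφ⟩ := hmem
  set p : V → ℝ := fun v => φ (Pi.single v 1) with hp
  have hpf : ∀ e, ((edgeInc G ℝ)ᵀ *ᵥ p) e = if e = f then 1 else 0 := fun e => by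
    have h1 := LinearMap.congr_fun hφ (Pi.single e 1)
    have h2 : φ (edgeInc G ℝ *ᵥ Pi.single e 1) = ((edgeInc G ℝ)ᵀ *ᵥ p) e := by
      rw [mulVec_single_one, ← (LinearMap.pi_apply_eq_sum_univ φ _).symm]
      simp only [mulVec, dotProduct, hp, transpose_apply, col_apply, smul_eq_mul]
      refine Finset.sum_congr rfl fun i _ => ?_
      congr 2
      ext j
      simp [Pi.single_apply, eq_comm]
    rw [← h2]
    simpa [Pi.single_apply, eq_comm] using h1
  obtain ⟨c, d, hcd, hf, hc0⟩ : ∃ (c d : V) (hcd : G.Adj c d), f = ⟨s(c, d), hcd⟩ ∧ p c ≠ 0 := by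
    obtain ⟨e, he⟩ := f
    induction e using Sym2.ind with
    | _ c d =>
      by_cases hc : p c = 0
      · refine ⟨d, c, SimpleGraph.Adj.symm he, by simp [Sym2.eq_swap], fun hd => ?_⟩
        have h1 := hpf ⟨s(c, d), he⟩
        rw [edgeInc_transpose_mulVec_apply G p he, if_pos rfl, hc, hd] at h1
        norm_num at h1
      · exact ⟨c, d, he, rfl, hc⟩
  set q : V → ℤ := fun v => if p v = p c then 1 else if p v = -p c then -1 else 0 with hq
  have hadj : ∀ v w, p v + p w = 0 → q v + q w = 0 := fun v w h => by
    have hw : p w = -p v := by linarith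
    have hcc : p c ≠ -p c := fun h => hc0 (self_eq_neg.1 h)
    simp only [hq, hw, neg_inj]
    by_cases h1 : p v = p c
    · simp [h1, hcc.symm]
    · by_cases h2 : p v = -p c
      · simp [h2, hcc.symm]
      · have h3 : -p v ≠ p c := fun h => h2 (by linarith)
        simp [h1, h2, h3]
  have hqe : ∀ e, ((edgeInc G ℤ)ᵀ *ᵥ q) e = if e = f then q c + q d else 0 := by
    rintro ⟨e, he⟩
    induction e using Sym2.ind with
    | _ v w =>
      split_ifs with h
      · rw [h, hf, edgeInc_transpose_mulVec_apply G q hcd]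
      · have h1 := hpf ⟨s(v, w), he⟩
        rw [if_neg h, edgeInc_transpose_mulVec_apply G p he] at h1
        rw [edgeInc_transpose_mulVec_apply G q he]
        exact hadj v w h1
  have hsum : (r : ℤ) * ∑ v, q v = q c + q d := by
    have h1 : ∑ e, ((edgeInc G ℤ)ᵀ *ᵥ q) e = r * ∑ v, q v := by
      simp only [mulVec, dotProduct, transpose_apply]
      rw [Finset.sum_comm, Finset.mul_sum]
      simp only [← Finset.sum_mul, sum_edgeInc_row G hreg]
    rw [← h1]
    simp only [hqe]
    simp
  have hqc : q c = 1 := by simp [hq]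
  have hqd : q d = 0 ∨ q d = 1 := by
    have h1 := hpf f
    rw [if_pos rfl, hf, edgeInc_transpose_mulVec_apply G p hcd] at h1
    simp only [hq]
    split_ifs with h2 h3
    · right; rfl
    · rw [h3] at h1; norm_num at h1
    · left; rfl
  have hr3' : (3 : ℤ) ≤ r := by exact_mod_cast hr3
  have hpos : 0 < ∑ v, q v := by
    by_contra hneg
    push Not at hneg
    have : (r : ℤ) * ∑ v, q v ≤ 0 := mul_nonpos_of_nonneg_of_nonpos (by omega) hneg
    omega
  have : (3 : ℤ) * 1 ≤ r * ∑ v, q v := mul_le_mul hr3' hpos (by norm_num) (by omega)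
  omega

/-- A fixed vector of the shifted Laplacian of a connected graph is constant on the original
vertices and constant on the new vertices. -/
theorem exists_const_of_qShift_mulVec_eq_self {r : ℕ} (hconn : G.Connected)
    (hreg : G.IsRegularOfDegree r) {s : V ⊕ G.edgeSet → ℝ} (hs : qShift G ℝ r *ᵥ s = s) :
    ∃ c : ℝ, (∀ v, s (Sum.inl v) = c) ∧ ∀ e, r * s (Sum.inr e) = -2 * c := by
  obtain ⟨α, β, rfl⟩ : ∃ α β, s = Sum.elim α β := ⟨_, _, (Sum.elim_comp_inl_inr s).symm⟩
  rw [qShift_mulVec] at hs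
  have h1 : edgeInc G ℝ *ᵥ β = (-2 : ℝ) • α := by
    ext v
    have := congrFun hs (Sum.inl v)
    simp only [Sum.elim_inl, Pi.sub_apply, Pi.neg_apply] at this
    rw [Pi.smul_apply, smul_eq_mul]; linarith
  have h2 : (r : ℝ) • β = -((edgeInc G ℝ)ᵀ *ᵥ α) := by
    ext e
    have := congrFun hs (Sum.inr e)
    rw [h1, mulVec_smul] at this
    simp only [Sum.elim_inr, Pi.sub_apply, Pi.add_apply, Pi.neg_apply, Pi.smul_apply,
      smul_eq_mul] at this
    simp only [Pi.smul_apply, Pi.neg_apply, smul_eq_mul]; linarith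
  have h3 : G.lapMatrix ℝ *ᵥ α = 0 := by
    have h4 := congrArg (fun x => edgeInc G ℝ *ᵥ x) h2
    simp only [mulVec_smul, mulVec_neg, h1, edgeInc_mulVec_transpose_mulVec G hreg] at h4
    ext v
    have h5 := congrFun h4 v
    simp only [Pi.smul_apply, Pi.neg_apply, Pi.add_apply, smul_eq_mul] at h5
    rw [SimpleGraph.lapMatrix, sub_mulVec, Pi.sub_apply, SimpleGraph.degMatrix_mulVec_apply,
      hreg.degree_eq v, Pi.zero_apply]
    linarith
  rw [SimpleGraph.lapMatrix_mulVec_eq_zero_iff_forall_reachable] at h3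
  obtain ⟨v₀⟩ := hconn.nonempty
  refine ⟨α v₀, fun v => h3 v v₀ (hconn.preconnected v v₀), ?_⟩
  rintro ⟨e, he⟩
  induction e using Sym2.ind with
  | _ v w =>
    have h4 := congrFun h2 ⟨s(v, w), he⟩
    rw [Pi.neg_apply, edgeInc_transpose_mulVec_apply G α he, h3 v v₀ (hconn.preconnected v v₀),
      h3 w v₀ (hconn.preconnected w v₀)] at h4
    simp only [Pi.smul_apply, smul_eq_mul] at h4
    rw [Sum.elim_inr, h4]; ring

/-- A rational eigenvalue of `qShift` is an integer dividing `r + 1`, since `(r + 1) / ν` is an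
eigenvalue of the integral matrix `qCoshift`. -/
theorem exists_int_eigenvalue {r : ℕ} (hreg : G.IsRegularOfDegree r) {ν : ℝ} {q : ℚ}
    (hq : ν = q) {z : V ⊕ G.edgeSet → ℝ} (h0 : z ≠ 0) (hz : qShift G ℝ r *ᵥ z = ν • z) :
    ∃ n : ℤ, ν = n ∧ n ∣ (r + 1 : ℤ) := by
  have h1 : (r + 1 : ℝ) • z = ν • (qCoshift G ℝ *ᵥ z) := by
    rw [← mulVec_smul, ← hz, mulVec_mulVec, qCoshift_mul_qShift G hreg, smul_mulVec, one_mulVec]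
  have hN : (r + 1 : ℝ) ≠ 0 := by positivity
  have hν : ν ≠ 0 := by
    rintro rfl
    rw [zero_smul] at h1
    exact h0 ((smul_eq_zero.1 h1).resolve_left hN)
  have h2 : qCoshift G ℝ *ᵥ z = ((r + 1) / ν) • z := by
    rw [div_eq_inv_mul, ← smul_smul, h1, smul_smul, inv_mul_cancel₀ hν, one_smul]
  obtain ⟨n, hn⟩ := exists_int_of_isIntegral_of_rat
    (isIntegral_of_mulVec_eq (qShift G ℤ r) h0
      ((congrArg (· *ᵥ z) (qShift_map G (Int.castRingHom ℝ) r)).trans hz)) hq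
  obtain ⟨m, hm⟩ := exists_int_of_isIntegral_of_rat
    (isIntegral_of_mulVec_eq (qCoshift G ℤ) h0
      ((congrArg (· *ᵥ z) (qCoshift_map G (Int.castRingHom ℝ))).trans h2))
    (q := (r + 1) / q) (by rw [hq]; push_cast; rfl)
  refine ⟨n, hn, m, ?_⟩
  rw [div_eq_iff hν, hn] at hm
  have : (r + 1 : ℝ) = n * m := by rw [hm]; ring
  exact_mod_cast this

theorem eq_of_forall_eigenvector {r : ℕ} {x y : V ⊕ G.edgeSet → ℝ}
    (H : ∀ (ν : ℝ) (z : V ⊕ G.edgeSet → ℝ), qShift G ℝ r *ᵥ z = ν • z → z ⬝ᵥ y = z ⬝ᵥ x) :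
    y = x := by
  refine sub_eq_zero.1 (eq_zero_of_forall_eigenvector (qShift_isSymm G (α := ℝ) r) ?_)
  intro ν z hz
  rw [dotProduct_sub, H ν z hz, sub_self]

/-- The sum of the states `e_a - e_f` and `e_b - e_g` has a component along an eigenvector with
eigenvalue other than `±1`: otherwise its image under `qShift + 1` would be a fixed integral vector,
hence constant on the original vertices, with a value `c` dividing `4` and `r ∣ 2c`. -/
theorem not_forall_dotProduct_realPair_add_eq_zero {r : ℕ} (hconn : G.Connected)
    (hreg : G.IsRegularOfDegree r) (hr3 : 3 ≤ r) (hodd : ¬ 2 ∣ r) (a b : V) (f g : G.edgeSet)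
    (H : ∀ (ν : ℝ) (z : V ⊕ G.edgeSet → ℝ), qShift G ℝ r *ᵥ z = ν • z → ν ^ 2 ≠ 1 →
      z ⬝ᵥ (realPair (Sum.inl a) (Sum.inr f) + realPair (Sum.inl b) (Sum.inr g)) = 0) :
    False := by
  set x : V ⊕ G.edgeSet → ℝ :=
    realPair (Sum.inl a) (Sum.inr f) + realPair (Sum.inl b) (Sum.inr g) with hx
  set s := qShift G ℝ r *ᵥ x + x with hs
  have hfix : qShift G ℝ r *ᵥ s = s := by
    refine eq_of_forall_eigenvector (r := r) fun ν z hz => ?_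
    have h1 : z ⬝ᵥ s = (ν + 1) * (z ⬝ᵥ x) := by
      rw [hs, dotProduct_add, dotProduct_mulVec_of_eigenvector (qShift_isSymm G r) hz]; ring
    rw [dotProduct_mulVec_of_eigenvector (qShift_isSymm G r) hz, h1]
    by_cases hν : ν ^ 2 = 1
    · linear_combination (z ⬝ᵥ x) * hν
    · rw [H ν z hz hν]; ring
  obtain ⟨c, hcv, hce⟩ := exists_const_of_qShift_mulVec_eq_self hconn hreg hfix
  have hxi : x = Sum.elim (Pi.single a 1 + Pi.single b 1) (-(Pi.single f 1 + Pi.single g 1)) := by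
    ext (v | e)
    · simp [hx, realPair, Pi.single_apply]
    · simp [hx, realPair, Pi.single_apply]; ring
  -- the coordinates of `s` are integers
  have hint : ∀ i, ∃ n : ℤ, s i = n := by
    set xi : V ⊕ G.edgeSet → ℤ :=
      Sum.elim (Pi.single a 1 + Pi.single b 1) (-(Pi.single f 1 + Pi.single g 1)) with hxi'
    have hcast : ∀ i, x i = (xi i : ℝ) := by
      rintro (v | e)
      · simp [hxi, hxi', Pi.single_apply]
      · simp [hxi, hxi', Pi.single_apply]
    intro i
    refine ⟨(qShift G ℤ r *ᵥ xi + xi) i, ?_⟩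
    rw [hs, ← qShift_map G (Int.castRingHom ℝ) r]
    simp [mulVec, dotProduct, hcast]
  have hRx : ∀ v, s (Sum.inl v) = edgeInc G ℝ v f + edgeInc G ℝ v g := fun v => by
    rw [hs, hxi, qShift_mulVec, Pi.add_apply, Sum.elim_inl, Sum.elim_inl, mulVec_neg, mulVec_add,
      mulVec_single_one, mulVec_single_one]
    simp only [Pi.sub_apply, Pi.neg_apply, Pi.add_apply, col_apply]
    ring
  have hsum : (Fintype.card V : ℝ) * c = 4 := by
    have h1 : ∑ v, s (Sum.inl v) = 4 := by
      simp only [hRx, Finset.sum_add_distrib, sum_edgeInc_col]; norm_num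
    rw [← h1]
    simp [hcv]
  obtain ⟨k, hk⟩ := hint (Sum.inl a)
  obtain ⟨n, hn⟩ := hint (Sum.inr f)
  rw [hcv] at hk
  have h4 : (Fintype.card V : ℤ) * k = 4 := by rw [hk] at hsum; exact_mod_cast hsum
  have h5 : (r : ℤ) * n = -2 * k := by
    have := hce f
    rw [hn, hk] at this; exact_mod_cast this
  have h6 : r ∣ 8 := by
    have : (r : ℤ) ∣ 8 := ⟨-(n * Fintype.card V), by
      linear_combination (-2 : ℤ) * h4 + (Fintype.card V : ℤ) * h5⟩
    exact_mod_cast this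
  have h7 := Nat.le_of_dvd (by norm_num) h6
  interval_cases r <;> omega

theorem not_transfers_mixed_mixed {r t : ℕ} (hconn : G.Connected) (hreg : G.IsRegularOfDegree r)
    (hr3 : 3 ≤ r) (hr : r + 1 = 2 ^ t) (ht : t ≠ 0) {κ : ℂ} (hκ : ‖κ‖ = 1) {τ : ℝ} {a b : V}
    {f g : G.edgeSet}
    (hne : (s(Sum.inl a, Sum.inr f) : Sym2 (V ⊕ G.edgeSet)) ≠ s(Sum.inl b, Sum.inr g))
    (hT : Transfers G r κ τ (realPair (Sum.inl a) (Sum.inr f))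
      (realPair (Sum.inl b) (Sum.inr g))) : False := by
  set x : V ⊕ G.edgeSet → ℝ := realPair (Sum.inl a) (Sum.inr f) with hx
  set y : V ⊕ G.edgeSet → ℝ := realPair (Sum.inl b) (Sum.inr g) with hy
  have hyx : y ≠ x := fun h =>
    hne (sym2_eq_of_realPair_eq (σ := 1) Sum.inl_ne_inr Sum.inl_ne_inr (by rw [one_smul]; exact h))
  have hodd : ¬ 2 ∣ r := fun h2 => by
    obtain ⟨t, rfl⟩ := Nat.exists_eq_add_one_of_ne_zero ht
    rw [pow_succ] at hr; omega
  have hph1 : phase κ τ 1 = ((1 : ℝ) : ℂ) := by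
    have h1 := hT 1 _ (qShift_mulVec_const G hreg)
    rw [hx, hy, dotProduct_realPair, dotProduct_realPair] at h1
    simp only [Sum.elim_inl, Sum.elim_inr] at h1
    have h2 : (((r : ℝ) - -2 : ℝ) : ℂ) ≠ 0 := by
      rw [Complex.ofReal_ne_zero, sub_neg_eq_add]; positivity
    rw [Complex.ofReal_one]
    exact mul_right_cancel₀ h2 (by rw [← h1, one_mul])
  obtain ⟨k, hk, hkf⟩ := exists_ker_edgeInc_apply_ne_zero hreg hr3 f
  have hkx : (Sum.elim (0 : V → ℝ) k) ⬝ᵥ x ≠ 0 := by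
    rw [hx, dotProduct_realPair]; simpa using hkf
  obtain ⟨η, hη, hphN, -⟩ := exists_sign_of_eq_phase_mul hκ hkx
    (hT _ _ (qShift_mulVec_of_ker G (r := r) hk))
  obtain ⟨m, hm⟩ := exists_int_of_phase_eq_sign hκ hη (Or.inl rfl) hphN hph1
  have hm' : τ / Real.pi * r = m := by rw [← hm]; ring
  have hr0 : (r : ℝ) ≠ 0 := by norm_cast; omega
  by_cases hm0 : m = 0
  · -- the time is `0`
    have hτ : τ = 0 := by
      rw [hm0, Int.cast_zero] at hm'
      have := (mul_eq_zero.1 hm').resolve_right hr0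
      exact (div_eq_zero_iff.1 this).resolve_right Real.pi_ne_zero
    subst hτ
    refine hyx (eq_of_forall_eigenvector (r := r) fun ν z hz => ?_)
    have h1 := hT ν z hz
    have h2 : phase κ 0 ν = 1 := by
      rw [← Complex.ofReal_one, ← hph1]; simp [phase]
    rw [h2, one_mul] at h1
    exact_mod_cast h1
  have hm0' : (m : ℝ) ≠ 0 := by exact_mod_cast hm0
  have hsupp : ∀ (ν : ℝ) (z : V ⊕ G.edgeSet → ℝ), qShift G ℝ r *ᵥ z = ν • z → z ⬝ᵥ x ≠ 0 →
      phase κ τ ν = η ∨ ν = 1 ∨ (ν = -1 ∧ phase κ τ ν = 1) := by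
    intro ν z hz hzx
    obtain ⟨s, hs, hphs, -⟩ := exists_sign_of_eq_phase_mul hκ hzx (hT ν z hz)
    obtain ⟨j, hj⟩ := exists_int_of_phase_eq_sign hκ hs (Or.inl rfl) hphs hph1
    have hrat : ν = ((1 + j * r / m : ℚ) : ℝ) := by
      have : m * (ν - 1) = j * r := by rw [← hm', ← hj]; ring
      push_cast
      field_simp
      linarith
    obtain ⟨n, hn, hdvd⟩ := exists_int_eigenvalue hreg hrat
      (fun h => hzx (by rw [h, zero_dotProduct])) hz
    have hrel : m * (n - 1) = j * r := by
      have : m * (ν - 1) = j * r := by rw [← hm', ← hj]; ring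
      rw [hn] at this; exact_mod_cast this
    have hoddr : Odd (r : ℤ) := by
      rw [← Int.not_even_iff_odd, even_iff_two_dvd]
      exact_mod_cast hodd
    rcases Int.even_or_odd n with he | ho
    · left
      obtain ⟨i, hi⟩ : Even (j - m) := by
        have h1 : (j - m) * r = m * (n - (r + 1)) := by linear_combination -hrel
        have h2 : Even ((j - m) * r) := by
          rw [h1]
          exact Even.mul_left (he.sub (hoddr.add_odd odd_one)) _
        exact (Int.even_mul.1 h2).resolve_right (Int.not_even_iff_odd.2 hoddr)
      rw [← hphN]
      refine (phase_eq_phase_iff hκ).2 ⟨i, ?_⟩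
      have : τ / Real.pi * (ν - (r + 1)) = (j - m : ℤ) := by
        push_cast; rw [← hj, ← hm']; ring
      rw [this, hi]; push_cast; ring
    · right
      have hcop : IsCoprime n (2 ^ t) := by
        refine IsCoprime.pow_right ?_
        obtain ⟨w, rfl⟩ := ho
        exact ⟨1, -w, by ring⟩
      have hr' : (r + 1 : ℤ) = 2 ^ t := by exact_mod_cast hr
      have hu := hcop.isUnit_of_dvd' dvd_rfl (by rwa [hr'] at hdvd)
      rcases Int.isUnit_iff.1 hu with rfl | rfl
      · left; rw [hn]; norm_num
      · right
        refine ⟨by rw [hn]; norm_num, ?_⟩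
        obtain ⟨i, hi⟩ : Even j := by
          have h2 : Even (j * r) := by
            rw [← hrel]; exact Even.mul_left (by decide) _
          exact (Int.even_mul.1 h2).resolve_right (Int.not_even_iff_odd.2 hoddr)
        rw [← Complex.ofReal_one, ← hph1]
        refine (phase_eq_phase_iff hκ).2 ⟨i, ?_⟩
        rw [hj, hi]; push_cast; ring
  have hzero : ∀ (ν : ℝ) (z : V ⊕ G.edgeSet → ℝ), qShift G ℝ r *ᵥ z = ν • z → z ⬝ᵥ x = 0 →
      z ⬝ᵥ y = 0 := fun ν z hz h => by
    have := hT ν z hz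
    rw [h, Complex.ofReal_zero, mul_zero] at this
    exact_mod_cast this
  rcases hη with rfl | rfl
  · refine hyx (eq_of_forall_eigenvector (r := r) fun ν z hz => ?_)
    by_cases hzx : z ⬝ᵥ x = 0
    · rw [hzx, hzero ν z hz hzx]
    have h1 : phase κ τ ν = 1 := by
      rcases hsupp ν z hz hzx with h | rfl | h
      · rw [h, Complex.ofReal_one]
      · rw [hph1, Complex.ofReal_one]
      · exact h.2
    have h2 := hT ν z hz
    rw [h1, one_mul] at h2
    exact_mod_cast h2
  · refine not_forall_dotProduct_realPair_add_eq_zero hconn hreg hr3 hodd a b f g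
      fun ν z hz hν => ?_
    rw [← hx, ← hy, dotProduct_add]
    by_cases hzx : z ⬝ᵥ x = 0
    · rw [hzx, hzero ν z hz hzx, add_zero]
    rcases hsupp ν z hz hzx with h | rfl | h
    · have h2 := hT ν z hz
      rw [h] at h2
      have h3 : z ⬝ᵥ y = -1 * (z ⬝ᵥ x) := by exact_mod_cast h2
      rw [h3]; ring
    · norm_num at hν
    · rw [h.1] at hν; norm_num at hν

/-! ### Combination of the cases -/

/-- A pair consisting of an original and a new vertex is the only kind of pair whose state has a
component along the constant-on-both-parts eigenvector. -/
theorem not_abs_eq_mixed {r : ℕ} (hreg : G.IsRegularOfDegree r) {x : V ⊕ G.edgeSet → ℝ} {a : V}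
    {f : G.edgeSet}
    (hx : (Sum.elim (fun _ => (r : ℝ)) (fun _ => -2)) ⬝ᵥ x = 0)
    (hT : ∀ (ν : ℝ) (z : V ⊕ G.edgeSet → ℝ), qShift G ℝ r *ᵥ z = ν • z →
      |z ⬝ᵥ x| = |z ⬝ᵥ realPair (Sum.inl a) (Sum.inr f)|) : False := by
  have h := hT 1 _ (qShift_mulVec_const G hreg)
  rw [hx, dotProduct_realPair, abs_zero, eq_comm, abs_eq_zero] at h
  simp only [Sum.elim_inl, Sum.elim_inr] at h
  have : (0 : ℝ) ≤ r := by positivity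
  linarith

theorem realPair_inl_inl (a b : V) :
    (realPair (Sum.inl a) (Sum.inl b) : V ⊕ G.edgeSet → ℝ) =
      Sum.elim (realPair a b) (0 : G.edgeSet → ℝ) := by
  ext (v | e) <;> simp [realPair, Pi.single_apply]

theorem realPair_inr_inr (f g : G.edgeSet) :
    (realPair (Sum.inr f) (Sum.inr g) : V ⊕ G.edgeSet → ℝ) =
      Sum.elim (0 : V → ℝ) (realPair f g) := by
  ext (v | e) <;> simp [realPair, Pi.single_apply]

end Cases

theorem theorem3p4 {V : Type*} [Fintype V] [DecidableEq V] (G : SimpleGraph V)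
    [DecidableRel G.Adj] (r t : ℕ) (hconn : G.Connected) (hreg : G.IsRegularOfDegree r)
    (ht : 2 ≤ t) (hr : r + 1 = 2 ^ t) :
    ¬ HasPairLPST (qGraph G) := by
  have hr3 : 3 ≤ r := by
    have : 2 ^ 2 ≤ 2 ^ t := Nat.pow_le_pow_right (by norm_num) ht
    omega
  have ht0 : t ≠ 0 := by omega
  rintro ⟨a, b, c, d, τ, h⟩
  obtain ⟨κ, hκ, hT⟩ := exists_transfers_of_pairLPSTAt hreg h
  obtain ⟨hab, hcd, hne, -⟩ := h
  have hκ' : ‖-κ‖ = 1 := by rwa [norm_neg]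
  -- the sizes of the components, insensitive to the order of each pair
  have habs : ∀ (ν : ℝ) (z : V ⊕ G.edgeSet → ℝ), qShift G ℝ r *ᵥ z = ν • z →
      |z ⬝ᵥ realPair c d| = |z ⬝ᵥ realPair a b| := fun ν z hz => hT.abs_eq hκ hz
  have hswap : ∀ (z : V ⊕ G.edgeSet → ℝ) (i j : V ⊕ G.edgeSet),
      |z ⬝ᵥ realPair i j| = |z ⬝ᵥ realPair j i| := fun z i j => by
    rw [realPair_swap i j, dotProduct_neg, abs_neg]
  rcases a with a | a <;> rcases b with b | b <;> rcases c with c | c <;> rcases d with d | d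
  · rw [realPair_inl_inl, realPair_inl_inl] at hT
    refine not_transfers_vertex_vertex hreg hr3 hr hκ (fun h => hab (congrArg _ h))
      (fun h => hcd (congrArg _ h)) (fun h => hne ?_) hT
    simpa using congrArg (Sym2.map (Sum.inl : V → V ⊕ G.edgeSet)) h
  · exact not_abs_eq_mixed hreg (by simp [dotProduct_realPair])
      fun ν z hz => (habs ν z hz).symm
  · exact not_abs_eq_mixed hreg (by simp [dotProduct_realPair])
      fun ν z hz => (habs ν z hz).symm.trans (hswap _ _ _)
  · rw [realPair_inl_inl, realPair_inr_inr] at habs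
    exact not_abs_eq_vertex_edge hreg (fun h => hab (congrArg _ h)) fun ν z hz => (habs ν z hz).symm
  · exact not_abs_eq_mixed hreg (by simp [dotProduct_realPair]) habs
  · exact not_transfers_mixed_mixed hconn hreg hr3 hr ht0 hκ hne hT
  · rw [realPair_swap (Sum.inr c)] at hT
    have hT' := hT.neg_right
    rw [neg_neg] at hT'
    rw [Sym2.eq_swap (a := Sum.inr c)] at hne
    exact not_transfers_mixed_mixed hconn hreg hr3 hr ht0 hκ' hne hT'
  · exact not_abs_eq_mixed hreg (by simp [dotProduct_realPair]) habs
  · exact not_abs_eq_mixed hreg (by simp [dotProduct_realPair])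
      fun ν z hz => (habs ν z hz).trans (hswap _ _ _)
  · rw [realPair_swap (Sum.inr a)] at hT
    have hT' := hT.neg_left
    rw [neg_neg] at hT'
    rw [Sym2.eq_swap (a := Sum.inr a)] at hne
    exact not_transfers_mixed_mixed hconn hreg hr3 hr ht0 hκ' hne hT'
  · rw [realPair_swap (Sum.inr a), realPair_swap (Sum.inr c)] at hT
    have hT' := hT.neg_left.neg_right
    rw [neg_neg, neg_neg, neg_neg] at hT'
    rw [Sym2.eq_swap (a := Sum.inr a), Sym2.eq_swap (a := Sum.inr c)] at hne
    exact not_transfers_mixed_mixed hconn hreg hr3 hr ht0 hκ hne hT'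
  · exact not_abs_eq_mixed hreg (by simp [dotProduct_realPair])
      fun ν z hz => (habs ν z hz).trans (hswap _ _ _)
  · rw [realPair_inl_inl, realPair_inr_inr] at habs
    exact not_abs_eq_vertex_edge hreg (fun h => hcd (congrArg _ h)) habs
  · exact not_abs_eq_mixed hreg (by simp [dotProduct_realPair])
      fun ν z hz => (habs ν z hz).symm
  · exact not_abs_eq_mixed hreg (by simp [dotProduct_realPair])
      fun ν z hz => (habs ν z hz).symm.trans (hswap _ _ _)
  · rw [realPair_inr_inr, realPair_inr_inr] at hT
    refine not_transfers_edge_edge hreg hr3 hr ht0 hκ (fun h => hab (congrArg _ h))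
      (fun h => hcd (congrArg _ h)) (fun h => hne ?_) hT
    simpa using congrArg (Sym2.map (Sum.inr : G.edgeSet → V ⊕ G.edgeSet)) h
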